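/- **Theorem 3.** Let $R=\mathbb{Z}[t_{i,j}]$ be the polynomial ring in independent variables $t_{i,j}$, $i,j=0,1,2,\dots$, and let $I\subset R$ be the ideal generated by the $t_{i,j}$ with $i\le j$. Let $\hat R_I\hat\otimes_{\mathbb Z}\mathbb{Q}=\varprojlim_k (R/I^k)\otimes_{\mathbb Z}\mathbb{Q}$ be the $I$-adic completion of $\mathbb{Q}[t_{i,j}]$. Let $m,n\ge 0$ and $l_1\le\dots\le l_n$ be integers, and consider the differential operator $$D=(x\partial_x-l_1)\cdots(x\partial_x-l_n)+\sum_{0\le j\le m,\ 0\le i}t_{i,j}\,x^i\partial_x^j .$$ For a prime $p$, the reduction $D^{(p)}$ of $D$ modulo $p$ acts on $(R/pR)[[x]]$ and preserves the closed span $x^p(R/pR)[[x]]$ of $x^p,x^{p+1},\dots$; let $Det_p(D)\in R/pR$ be the determinant of $D^{(p)}$ on the quotient, which is free with basis $1,x,\dots,x^{p-1}$. Then there exist an element $L(D)\in\hat R_I\hat\otimes_{\mathbb Z}\mathbb{Q}$ and a real number $C>0$, both independent of $p$ (they may depend on $n$, $m$, $l_1,\dots,l_n$), such that for every prime $p$ $$Det_p(D)=L(D)\quad\text{mod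 } p\ \text{ and } I^{\lceil Cp\rceil},$$ that is, with $k=\lceil Cp\rceil$: the image of $L(D)$ in $(R/I^k)\otimes\mathbb{Q}$ has no $p$ in its denominators (it is of the form $r/s$ with $r\in R$ and $s$ an integer prime to $p$), and its reduction modulo $p$ equals the image of $Det_p(D)$ in $R/(pR+I^k)$. -/

import Mathlib

open scoped PowerSeries

noncomputable section

namespace PDet

/-- `x ∂`, acting on formal power series in `x` over `A`. -/
def euler (A : Type*) [CommRing A] : Module.End A A⟦X⟧ :=
  LinearMap.mulLeft A (PowerSeries.X : A⟦X⟧) ∘ₗ (PowerSeries.derivative A).toLinearMap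

/-- The operator `(x∂ - l₁) ⋯ (x∂ - lₙ) + ∑_{0 ≤ j ≤ m, 0 ≤ i} t i j x^i ∂^j` on `A⟦x⟧`.
The coefficient of `∂^j` is the power series `∑_{i ≥ 0} t i j x^i`. -/
def diffOp {A : Type*} [CommRing A] {n : ℕ} (l : Fin n → ℤ) (m : ℕ) (t : ℕ → ℕ → A) :
    Module.End A A⟦X⟧ :=
  (List.ofFn fun s => euler A - algebraMap A (Module.End A A⟦X⟧) (l s : A)).prod +
    ∑ j ∈ Finset.range (m + 1),
      LinearMap.mulLeft A (PowerSeries.mk fun i => t i j) ∘ₗ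
        (PowerSeries.derivative A).toLinearMap ^ j

/-- The (closed) span of `x^p, x^(p+1), …` in `A⟦x⟧`. -/
def tail (A : Type*) [CommRing A] (p : ℕ) : Submodule A A⟦X⟧ where
  carrier := {f | ∀ i < p, PowerSeries.coeff i f = 0}
  add_mem' := fun {f g} hf hg i hi => by simp [hf i hi, hg i hi]
  zero_mem' := fun i _ => by simp
  smul_mem' := fun c f hf i hi => by simp [hf i hi]

theorem mul_mem_tail {A : Type*} [CommRing A] (p : ℕ) (g : A⟦X⟧) {f : A⟦X⟧}
    (hf : f ∈ tail A p) : g * f ∈ tail A p := by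
  intro i hi
  rw [PowerSeries.coeff_mul]
  refine Finset.sum_eq_zero fun x hx => ?_
  have hx' := Finset.HasAntidiagonal.mem_antidiagonal.mp hx
  rw [hf x.2 (by omega), mul_zero]

theorem derivative_mem_tail {A : Type*} [CommRing A] {p : ℕ} (hp : (p : A) = 0) {f : A⟦X⟧}
    (hf : f ∈ tail A p) : PowerSeries.derivative A f ∈ tail A p := by
  intro i hi
  rw [PowerSeries.coeff_derivative]
  rcases Nat.lt_or_ge (i + 1) p with h | h
  · rw [hf _ h, zero_mul]
  · have h2 : i + 1 = p := by omega
    have h3 : (i : A) + 1 = 0 := by rw [← hp, ← h2]; push_cast; rfl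
    rw [h3, mul_zero]

theorem derivative_pow_mem_tail {A : Type*} [CommRing A] {p : ℕ} (hp : (p : A) = 0) (j : ℕ)
    {f : A⟦X⟧} (hf : f ∈ tail A p) :
    ((PowerSeries.derivative A).toLinearMap ^ j) f ∈ tail A p := by
  induction j with
  | zero => simpa using hf
  | succ j ih =>
    rw [pow_succ']
    exact derivative_mem_tail hp ih

theorem list_prod_mem_tail {A : Type*} [CommRing A] {p : ℕ} (L : List (Module.End A A⟦X⟧))
    (hL : ∀ T ∈ L, ∀ f ∈ tail A p, T f ∈ tail A p) {f : A⟦X⟧} (hf : f ∈ tail A p) :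
    L.prod f ∈ tail A p := by
  induction L with
  | nil => simpa using hf
  | cons T L ih =>
    rw [List.prod_cons]
    exact hL T (by simp) _ (ih fun S hS => hL S (by simp [hS]))

/-- If `p = 0` in `A`, the span of `x^p, x^(p+1), …` is invariant under the operator. -/
theorem tail_le_comap {A : Type*} [CommRing A] {p : ℕ} (hp : (p : A) = 0) {n : ℕ}
    (l : Fin n → ℤ) (m : ℕ) (t : ℕ → ℕ → A) :
    tail A p ≤ (tail A p).comap (diffOp l m t) := by
  intro f hf
  rw [Submodule.mem_comap, diffOp, LinearMap.add_apply, LinearMap.sum_apply]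
  refine (tail A p).add_mem (list_prod_mem_tail _ ?_ hf) ((tail A p).sum_mem fun j _ => ?_)
  · intro T hT g hg
    obtain ⟨s, rfl⟩ := List.mem_ofFn.mp hT
    rw [LinearMap.sub_apply, Module.algebraMap_end_apply]
    exact (tail A p).sub_mem (mul_mem_tail p _ (derivative_mem_tail hp hg))
      ((tail A p).smul_mem _ hg)
  · exact mul_mem_tail p _ (derivative_pow_mem_tail hp j hf)

/-- The ring `R = ℤ[t_{ij}]`, `i, j = 0, 1, 2, …`. -/
abbrev R : Type := MvPolynomial (ℕ × ℕ) ℤ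

/-- The ideal of `R` generated by the `t_{ij}` with `i ≤ j`. -/
def I : Ideal R := Ideal.span {f | ∃ i j : ℕ, i ≤ j ∧ f = MvPolynomial.X (i, j)}

/-- The reduction `S / pS` of `S` modulo `p`. -/
abbrev RedMod (S : Type*) [CommRing S] (p : ℕ) : Type _ := S ⧸ Ideal.span {(p : S)}

theorem natCast_redMod (S : Type*) [CommRing S] (p : ℕ) : (p : RedMod S p) = 0 := by
  have h : Ideal.Quotient.mk (Ideal.span {(p : S)}) (p : S) = 0 :=
    Ideal.Quotient.eq_zero_iff_mem.mpr (Ideal.mem_span_singleton_self _)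
  rwa [map_natCast] at h

/-- The reduction of the operator modulo `p`, over `R / pR`. -/
def redOp {n : ℕ} (l : Fin n → ℤ) (m p : ℕ) : Module.End (RedMod R p) (RedMod R p)⟦X⟧ :=
  diffOp l m fun i j => Ideal.Quotient.mk _ (MvPolynomial.X (i, j))

/-- `Det_p(D)`: the determinant of the reduction of `D` modulo `p`, acting on the quotient by the
span of `x^p, x^(p+1), …`, which has the basis `1, x, …, x^(p-1)`. -/
def pDet {n : ℕ} (l : Fin n → ℤ) (m p : ℕ) : RedMod R p :=
  LinearMap.det ((tail (RedMod R p) p).mapQ (tail (RedMod R p) p) (redOp l m p)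
    (tail_le_comap (natCast_redMod R p) l m _))

/-- The ring `R ⊗ ℚ = ℚ[t_{ij}]`. -/
abbrev RQ : Type := MvPolynomial (ℕ × ℕ) ℚ

/-- The inclusion `R → R ⊗ ℚ`. -/
def toRQ : R →+* RQ := MvPolynomial.map (Int.castRingHom ℚ)

/-- The ideal `I ⊗ ℚ` of `R ⊗ ℚ`. -/
def IQ : Ideal RQ := I.map toRQ

/-- The completed tensor product of the `I`-adic completion of `R` with `ℚ`, i.e.
`lim_k (R / I^k) ⊗ ℚ = lim_k (R ⊗ ℚ) / (I ⊗ ℚ)^k`. -/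
abbrev CompletedRat : Type := AdicCompletion IQ RQ

/-- `d = L` modulo `p` and `I^k`, for `d ∈ R / pR` and `L` in the completion of `R ⊗ ℚ`:
modulo `I^k`, the element `L` is a fraction `r / s` with `r ∈ R` and an integer `s` prime to `p`
(so `L` modulo `I^k` has no `p` in the denominators), and the reduction of `r / s` modulo `p` is
`d` modulo the image of `I^k` in `R / pR`. Since `R / I^k` has no torsion, this does not depend on
the choice of the fraction. -/
def CongrMod (p k : ℕ) (d : RedMod R p) (L : CompletedRat) : Prop :=
  ∃ (r : R) (s : ℤ), IsCoprime s (p : ℤ) ∧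
    (s : RQ ⧸ IQ ^ k) * AdicCompletion.evalₐ IQ k L = Ideal.Quotient.mk (IQ ^ k) (toRQ r) ∧
    (s : RedMod R p) * d - Ideal.Quotient.mk (Ideal.span {(p : R)}) r ∈
      (I ^ k).map (Ideal.Quotient.mk (Ideal.span {(p : R)}))

end PDet

end

open scoped PowerSeries

noncomputable section

namespace PDet

/-! With `P(a) = ∏ (a - l s)`, the operator sends `x^a` to `P(a) x^a + ∑ t_ij a(a-1)⋯(a-j+1)
x^(a+i-j)`. Put a variable `s` before the perturbation `K` and expand `det (P + sK)` in powers of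
`s`. In each permutation term the displacements add up to zero and an entry of `K` lowers the index
by at most `m`; so of `k` entries of `K` at least `k / (m + 1)` lie in the ideal
(`coeff_pencil_mem`). Modulo the `K`-th power of the ideal only the `k < (m + 1) * K - m` matter,
and for `K = ⌈Cp⌉` these are small compared with `p`.

For such `k ≥ 1` the coefficient of `s^k` is given by a formula independent of `p`. The indices `0,
…, p - 1` may be taken cyclically, because over `A[z]/z^p`, with `x` rescaled by `z`, all words that
wrap around vanish (`coeff_pencil_truncMatrix`). Shift `a` to `a + ε`. Then `det (P + sK) = ∏ P(a +
ε) · det (1 + s K P⁻¹)`, the product is `(ε^p - ε)^n`, congruent to `(-ε)^n` modulo `ε^(p-1)`, and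
Newton's identities reduce the second factor to traces of powers of `K P⁻¹`. A trace is a sum over
words of degree zero of `∑ f(a + ε)`, where `a` runs over `ZMod p` and `f` is rational. By partial
fractions and the vanishing of `∑ a^j` for `j < p - 1`, only the polar parts of `f` survive to the
needed order (`coeff_sum_wordVal`), and the poles are at bounded integers independent of `p`.

The resulting formula `regDet` divides only by integers smaller than `p`. Evaluated over `ℤ_(p)[t]`,
it specializes both to `ℚ[t]`, where it defines the limit, and to `R / pR`, where it is the
determinant (`congrMod_regDetLimit`). -/

/-! ### Jacobi's formula and Newton's identities -/

theorem derivative_det {ι S : Type*} [Fintype ι] [DecidableEq ι] [CommRing S]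
    (M : Matrix ι ι (Polynomial S)) :
    Polynomial.derivative M.det = (M.adjugate * M.map Polynomial.derivative).trace := by
  -- By Cramer's rule a diagonal entry is the determinant with one column differentiated; the trace
  -- is then the Leibniz rule over the columns.
  have h1 : ∀ i, (M.adjugate * M.map Polynomial.derivative) i i =
      (M.updateCol i fun b => Polynomial.derivative (M b i)).det := by
    intro i
    rw [← Matrix.cramer_apply, Matrix.cramer_eq_adjugate_mulVec]
    simp [Matrix.mul_apply, Matrix.mulVec, dotProduct]
  rw [Matrix.trace]
  simp only [Matrix.diag_apply, h1]
  simp only [Matrix.det_apply', map_sum]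
  rw [Finset.sum_comm]
  refine Finset.sum_congr rfl fun σ _ => ?_
  rw [← Finset.mul_sum, Polynomial.derivative_intCast_mul, Polynomial.derivative_prod_finset]
  congr 1
  refine Finset.sum_congr rfl fun i _ => ?_
  rw [← Finset.prod_erase_mul _ _ (Finset.mem_univ i)]
  congr 1
  · refine Finset.prod_congr rfl fun j hj => ?_
    rw [Matrix.updateCol_ne (Finset.ne_of_mem_erase hj)]
  · simp

/-- The characteristic-type polynomial `det (1 + sK)`. -/
def fredholm {ι S : Type*} [Fintype ι] [DecidableEq ι] [CommRing S] (K : Matrix ι ι S) :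
    Polynomial S :=
  (1 + (Polynomial.X : Polynomial S) • K.map Polynomial.C).det

theorem fredholm_coeff_zero {ι S : Type*} [Fintype ι] [DecidableEq ι] [CommRing S]
    (K : Matrix ι ι S) : (fredholm K).coeff 0 = 1 := by
  rw [Polynomial.coeff_zero_eq_eval_zero, fredholm, ← Polynomial.coe_evalRingHom,
    RingHom.map_det]
  refine (congrArg Matrix.det ?_).trans Matrix.det_one
  ext i j
  by_cases h : i = j <;> simp [Matrix.one_apply, h]

/-- Newton's identities for the coefficients of `det (1 + sK)` and the traces of the powers
of `K`. -/
theorem fredholm_coeff_succ {ι S : Type*} [Fintype ι] [DecidableEq ι] [CommRing S]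
    (K : Matrix ι ι S) (k : ℕ) :
    ((k + 1 : ℕ) : S) * (fredholm K).coeff (k + 1) =
      ∑ i ∈ Finset.range (k + 1), (-1) ^ i * (fredholm K).coeff (k - i) * (K ^ (i + 1)).trace := by
  set N : Matrix ι ι (Polynomial S) := 1 + (Polynomial.X : Polynomial S) • K.map Polynomial.C
    with hN
  -- The coefficients of the adjugate. Comparing coefficients in `adj N * N = det N` gives a
  -- recursion, solved by an alternating sum of powers of `K`; Jacobi's formula then expresses the
  -- derivative of the determinant by the traces of the `B k * K`.
  let B : ℕ → Matrix ι ι S := fun k => N.adjugate.map fun f => f.coeff k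
  have hadj : N.adjugate * N = fredholm K • 1 := Matrix.adjugate_mul N
  have hadj' : N.adjugate + (Polynomial.X : Polynomial S) • (N.adjugate * K.map Polynomial.C) =
      fredholm K • 1 := by
    rw [← hadj, hN, mul_add, mul_one, Matrix.mul_smul]
  have hmul : ∀ k i j, ((N.adjugate * K.map Polynomial.C) i j).coeff k = (B k * K) i j := by
    intro k i j
    simp [Matrix.mul_apply, Polynomial.finsetSum_coeff, B]
  have hcoef : ∀ k, B (k + 1) + B k * K = (fredholm K).coeff (k + 1) • 1 := by
    intro k
    ext i j
    have := congrArg (fun M : Matrix ι ι (Polynomial S) => (M i j).coeff (k + 1)) hadj'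
    simp only [Matrix.add_apply, Matrix.smul_apply, smul_eq_mul, Polynomial.coeff_add,
      Polynomial.coeff_X_mul, hmul] at this
    rw [Matrix.add_apply, Matrix.smul_apply]
    refine this.trans ?_
    by_cases h : i = j <;> simp [Matrix.one_apply, h]
  have hB0 : B 0 = 1 := by
    ext i j
    have := congrArg (fun M : Matrix ι ι (Polynomial S) => (M i j).coeff 0) hadj'
    simp only [Matrix.add_apply, Matrix.smul_apply, smul_eq_mul, Polynomial.coeff_add,
      Polynomial.mul_coeff_zero, Polynomial.coeff_X_zero, zero_mul, add_zero,
      fredholm_coeff_zero] at this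
    refine this.trans ?_
    by_cases h : i = j <;> simp [Matrix.one_apply, h]
  have hB : ∀ k, B k = ∑ i ∈ Finset.range (k + 1),
      ((-1) ^ i * (fredholm K).coeff (k - i)) • K ^ i := by
    intro k
    induction k with
    | zero => simp [hB0, fredholm_coeff_zero]
    | succ k ih =>
      rw [eq_sub_of_add_eq (hcoef k), ih, Finset.sum_range_succ' _ (k + 1), Finset.sum_mul,
        sub_eq_neg_add, ← Finset.sum_neg_distrib]
      congr 1
      · refine Finset.sum_congr rfl fun i _ => ?_
        rw [Matrix.smul_mul, ← pow_succ, ← neg_smul, Nat.add_sub_add_right]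
        congr 1
        ring
      · simp
  have hd := derivative_det N
  have hN' : N.map Polynomial.derivative = K.map Polynomial.C := by
    ext1 i j
    by_cases h : i = j <;> simp [hN, h]
  have hc := congrArg (fun f : Polynomial S => f.coeff k) hd
  rw [hN'] at hc
  simp only [Polynomial.coeff_derivative, Matrix.trace, Matrix.diag_apply,
    Polynomial.finsetSum_coeff, hmul] at hc
  have hc' : (fredholm K).coeff (k + 1) * ((k : S) + 1) = (B k * K).trace := hc
  rw [mul_comm, Nat.cast_succ, hc', hB, Finset.sum_mul, Matrix.trace_sum]
  refine Finset.sum_congr rfl fun i _ => ?_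
  rw [Matrix.smul_mul, Matrix.trace_smul, ← pow_succ, smul_eq_mul]

/-- The sequence determined by Newton's identities from the power sums `τ 1, τ 2, …`. -/
def newton {S : Type*} [CommRing S] (τ : ℕ → S) : ℕ → S
  | 0 => 1
  | k + 1 => Ring.inverse ((k + 1 : ℕ) : S) *
      ∑ i : Fin (k + 1), (-1) ^ (i : ℕ) * newton τ (k - i) * τ (i + 1)

theorem newton_zero {S : Type*} [CommRing S] (τ : ℕ → S) : newton τ 0 = 1 := by
  rw [newton]

theorem newton_succ {S : Type*} [CommRing S] (τ : ℕ → S) (k : ℕ) :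
    newton τ (k + 1) = Ring.inverse ((k + 1 : ℕ) : S) *
      ∑ i ∈ Finset.range (k + 1), (-1) ^ i * newton τ (k - i) * τ (i + 1) := by
  rw [newton, Finset.sum_range fun i => (-1) ^ i * newton τ (k - i) * τ (i + 1)]

theorem map_ringInverse {S S' : Type*} [CommRing S] [CommRing S'] (f : S →+* S') {x : S}
    (hx : IsUnit x) : f (Ring.inverse x) = Ring.inverse (f x) := by
  obtain ⟨u, rfl⟩ := hx
  have : f u = (Units.map (f : S →* S') u : S'ˣ) := rfl
  rw [Ring.inverse_unit, this, Ring.inverse_unit, ← map_inv]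
  rfl

/-- Only integers up to `k` are divided by; this is one of the places where `k` has to be small
compared with `p`. -/
theorem newton_unique {S : Type*} [CommRing S] {τ F : ℕ → S} {k : ℕ}
    (hu : ∀ i, 1 ≤ i → i ≤ k → IsUnit ((i : ℕ) : S)) (h0 : F 0 = 1)
    (hF : ∀ i < k, ((i + 1 : ℕ) : S) * F (i + 1) =
      ∑ j ∈ Finset.range (i + 1), (-1) ^ j * F (i - j) * τ (j + 1)) :
    ∀ i ≤ k, F i = newton τ i := by
  intro i
  induction i using Nat.strong_induction_on with
  | _ i ih =>
    intro hi
    cases i with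
    | zero => rw [h0, newton_zero]
    | succ i =>
      rw [newton_succ, eq_comm, Ring.inverse_mul_eq_iff_eq_mul _ _ _ (hu _ (by omega) hi),
        hF i (by omega)]
      refine Finset.sum_congr rfl fun j hj => ?_
      rw [ih (i - j) (by omega) (by omega)]

theorem newton_congr {S : Type*} [CommRing S] {τ τ' : ℕ → S} {k : ℕ}
    (h : ∀ i, 1 ≤ i → i ≤ k → τ i = τ' i) : ∀ i ≤ k, newton τ i = newton τ' i := by
  intro i
  induction i using Nat.strong_induction_on with
  | _ i ih =>
    intro hi
    cases i with
    | zero => rw [newton_zero, newton_zero]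
    | succ i =>
      rw [newton_succ, newton_succ]
      congr 1
      refine Finset.sum_congr rfl fun j hj => ?_
      have := Finset.mem_range.mp hj
      rw [ih (i - j) (by omega) (by omega), h (j + 1) (by omega) (by omega)]

theorem map_newton {S S' : Type*} [CommRing S] [CommRing S'] (f : S →+* S') (τ : ℕ → S) {k : ℕ}
    (hu : ∀ i, 1 ≤ i → i ≤ k → IsUnit ((i : ℕ) : S)) :
    ∀ i ≤ k, f (newton τ i) = newton (fun j => f (τ j)) i := by
  refine newton_unique (fun i h1 h2 => by simpa using (hu i h1 h2).map f)
    (by simp only [newton_zero, map_one]) fun i hi => ?_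
  rw [newton_succ, ← map_natCast f, ← map_mul, Ring.mul_inverse_cancel_left _ _ (hu _ (by omega) hi)]
  simp

/-- The recursion is weighted homogeneous, with `τ i` of weight `i`. No inverse is cancelled, so no
integer has to be a unit. -/
theorem newton_homogeneous {S : Type*} [CommRing S] (τ : ℕ → S) (c : S) (k : ℕ) :
    newton (fun i => c ^ i * τ i) k = c ^ k * newton τ k := by
  induction k using Nat.strong_induction_on with
  | _ k ih =>
    cases k with
    | zero => simp [newton_zero]
    | succ k =>
      rw [newton_succ, newton_succ, mul_left_comm (c ^ (k + 1))]
      congr 1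
      rw [Finset.mul_sum]
      refine Finset.sum_congr rfl fun i hi => ?_
      have := Finset.mem_range.mp hi
      rw [ih (k - i) (by omega), show k + 1 = (k - i) + (i + 1) by omega, pow_add]
      ring

theorem fredholm_coeff {ι S : Type*} [Fintype ι] [DecidableEq ι] [CommRing S]
    (K : Matrix ι ι S) {k : ℕ} (hu : ∀ i, 1 ≤ i → i ≤ k → IsUnit ((i : ℕ) : S)) :
    (fredholm K).coeff k = newton (fun i => (K ^ i).trace) k :=
  newton_unique (τ := fun i => (K ^ i).trace) (F := fun i => (fredholm K).coeff i) hu (fredholm_coeff_zero K)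
    (fun i _ => fredholm_coeff_succ K i) k le_rfl

/-! ### Words in the operators and traces of powers -/

/-- The degree of a word in the operators `x^i ∂^j`, where `x^i ∂^j` has degree `i - j`. -/
def shift (w : List (ℕ × ℕ)) : ℤ := (w.map fun x => (x.1 : ℤ) - x.2).sum

@[simp]
theorem shift_nil : shift [] = 0 := rfl

@[simp]
theorem shift_cons (x : ℕ × ℕ) (w : List (ℕ × ℕ)) :
    shift (x :: w) = ((x.1 : ℤ) - x.2) + shift w := by
  simp [shift]

theorem shift_append (u v : List (ℕ × ℕ)) : shift (u ++ v) = shift u + shift v := by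
  simp [shift]

theorem neg_le_shift {m : ℕ} (w : List (ℕ × ℕ)) (hw : ∀ x ∈ w, x.2 ≤ m) :
    -((m : ℤ) * w.length) ≤ shift w := by
  induction w with
  | nil => simp
  | cons x w ih =>
    have h1 := ih fun y hy => hw y (by simp [hy])
    have h2 := hw x (by simp)
    rw [shift_cons, List.length_cons]
    push_cast
    have h3 : (x.2 : ℤ) ≤ m := by exact_mod_cast h2
    have h4 : (0 : ℤ) ≤ x.1 := by positivity
    linarith

/-- A suffix and the complementary prefix have opposite degrees, and neither can fall by more than
`m` per letter. Hence the orbit of a word of degree zero stays within `m * w.length` of its start.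
-/
theorem abs_shift_suffix_le {m : ℕ} {w v : List (ℕ × ℕ)} (hw : ∀ x ∈ w, x.2 ≤ m)
    (h0 : shift w = 0) (hv : v <:+ w) : |shift v| ≤ m * w.length := by
  obtain ⟨u, rfl⟩ := hv
  have hu := neg_le_shift u fun x hx => hw x (by simp [hx])
  have hv := neg_le_shift v fun x hx => hw x (by simp [hx])
  rw [shift_append] at h0
  have h1 : (0 : ℤ) ≤ m * u.length := by positivity
  have h2 : (0 : ℤ) ≤ m * v.length := by positivity
  rw [abs_le, List.length_append]
  push_cast
  constructor <;> linarith

/-- The product of the values of the factors of a word along its orbit starting at `a`. -/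
def wordVal {ι S : Type*} [Ring ι] [CommRing S] (G : ℕ → ι → S) : List (ℕ × ℕ) → ι → S
  | [], _ => 1
  | x :: w, a => G x.2 (a + (shift w : ι)) * wordVal G w a

/-- Only the values along the orbit matter, so the orbit may be read in `ℤ` or in `ZMod p`. -/
theorem map_wordVal {ι ι' S S' : Type*} [Ring ι] [Ring ι'] [CommRing S] [CommRing S']
    (f : S →+* S') {G : ℕ → ι → S} {G' : ℕ → ι' → S'} {a : ι} {a' : ι'} (w : List (ℕ × ℕ))
    (h : ∀ v, v <:+ w → ∀ j, f (G j (a + (shift v : ι))) = G' j (a' + (shift v : ι'))) :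
    f (wordVal G w a) = wordVal G' w a' := by
  induction w with
  | nil => simp [wordVal]
  | cons x w ih =>
    rw [wordVal, wordVal, map_mul, ih fun v hv => h v (hv.trans (List.suffix_cons x w)),
      h w (List.suffix_cons x w)]

/-- The sum over the words of length `r` with letters in `Λ`. -/
def wordSum {S : Type*} [AddCommMonoid S] (Λ : Finset (ℕ × ℕ)) :
    ℕ → (List (ℕ × ℕ) → S) → S
  | 0, Ψ => Ψ []
  | r + 1, Ψ => ∑ x ∈ Λ, wordSum Λ r fun w => Ψ (x :: w)

theorem wordSum_congr {S : Type*} [AddCommMonoid S] {Λ : Finset (ℕ × ℕ)} {r : ℕ}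
    {Ψ Ψ' : List (ℕ × ℕ) → S}
    (h : ∀ w : List (ℕ × ℕ), w.length = r → (∀ x ∈ w, x ∈ Λ) → Ψ w = Ψ' w) :
    wordSum Λ r Ψ = wordSum Λ r Ψ' := by
  induction r generalizing Ψ Ψ' with
  | zero => exact h [] rfl (by simp)
  | succ r ih =>
    refine Finset.sum_congr rfl fun x hx => ih fun w hw hw' => h _ (by simp [hw]) ?_
    intro y hy
    rcases List.mem_cons.mp hy with rfl | hy
    · exact hx
    · exact hw' y hy

theorem wordSum_zero {S : Type*} [AddCommMonoid S] (Λ : Finset (ℕ × ℕ)) (r : ℕ) :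
    wordSum Λ r (fun _ => (0 : S)) = 0 := by
  induction r with
  | zero => rfl
  | succ r ih => exact Finset.sum_eq_zero fun x _ => ih

theorem wordSum_subset {S : Type*} [AddCommMonoid S] {Λ Λ' : Finset (ℕ × ℕ)} (hΛ : Λ ⊆ Λ')
    {r : ℕ} {Ψ : List (ℕ × ℕ) → S}
    (h : ∀ w : List (ℕ × ℕ), w.length = r → (∀ x ∈ w, x ∈ Λ') → (∃ x ∈ w, x ∉ Λ) → Ψ w = 0) :
    wordSum Λ r Ψ = wordSum Λ' r Ψ := by
  induction r generalizing Ψ with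
  | zero => rfl
  | succ r ih =>
    rw [wordSum, wordSum, ← Finset.sum_subset hΛ]
    · refine Finset.sum_congr rfl fun x hx => ih fun w hw hw' hw'' => h _ (by simp [hw]) ?_ ?_
      · intro y hy
        rcases List.mem_cons.mp hy with rfl | hy
        · exact hΛ hx
        · exact hw' y hy
      · obtain ⟨y, hy, hy'⟩ := hw''
        exact ⟨y, by simp [hy], hy'⟩
    · intro x hx hx'
      rw [← wordSum_zero Λ' r]
      refine wordSum_congr fun w hw hw' => h _ (by simp [hw]) ?_ ⟨x, by simp, hx'⟩
      intro y hy
      rcases List.mem_cons.mp hy with rfl | hy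
      · exact hx
      · exact hw' y hy

theorem map_wordSum {S S' F : Type*} [AddCommMonoid S] [AddCommMonoid S'] [FunLike F S S']
    [AddMonoidHomClass F S S'] (f : F) (Λ : Finset (ℕ × ℕ)) (r : ℕ) (Ψ : List (ℕ × ℕ) → S) :
    f (wordSum Λ r Ψ) = wordSum Λ r fun w => f (Ψ w) := by
  induction r generalizing Ψ with
  | zero => rfl
  | succ r ih => simp only [wordSum, map_sum, ih]

theorem mul_wordSum {S : Type*} [CommRing S] (c : S) (Λ : Finset (ℕ × ℕ)) (r : ℕ)
    (Ψ : List (ℕ × ℕ) → S) : c * wordSum Λ r Ψ = wordSum Λ r fun w => c * Ψ w :=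
  map_wordSum (AddMonoidHom.mulLeft c) Λ r Ψ

theorem wordSum_sum {S κ : Type*} [AddCommMonoid S] (s : Finset κ) (Λ : Finset (ℕ × ℕ)) (r : ℕ)
    (Ψ : κ → List (ℕ × ℕ) → S) :
    wordSum Λ r (fun w => ∑ a ∈ s, Ψ a w) = ∑ a ∈ s, wordSum Λ r (Ψ a) := by
  induction r generalizing Ψ with
  | zero => rfl
  | succ r ih =>
    simp only [wordSum, ih]
    rw [Finset.sum_comm]

theorem wordSum_mem {S : Type*} [AddCommMonoid S] (N : AddSubmonoid S) {Λ : Finset (ℕ × ℕ)}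
    {r : ℕ} {Ψ : List (ℕ × ℕ) → S}
    (h : ∀ w : List (ℕ × ℕ), w.length = r → (∀ x ∈ w, x ∈ Λ) → Ψ w ∈ N) :
    wordSum Λ r Ψ ∈ N := by
  induction r generalizing Ψ with
  | zero => exact h [] rfl (by simp)
  | succ r ih =>
    refine N.sum_mem fun x hx => ih fun w hw hw' => h _ (by simp [hw]) ?_
    intro y hy
    rcases List.mem_cons.mp hy with rfl | hy
    · exact hx
    · exact hw' y hy

/-- The matrix of the operator `∑ T x^i ∂^j`, in a basis indexed cyclically, where `x^i ∂^j`
sends the basis vector with index `a` to `G j a` times the one with index `a + i - j`. -/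
def shiftMatrix {ι S : Type*} [Ring ι] [DecidableEq ι] [CommRing S]
    (Λ : Finset (ℕ × ℕ)) (T : ℕ × ℕ → S) (G : ℕ → ι → S) : Matrix ι ι S :=
  Matrix.of fun b a => ∑ x ∈ Λ,
    if b = a + (((x.1 : ℤ) - x.2 : ℤ) : ι) then T x * G x.2 a else 0

theorem shiftMatrix_pow_apply {ι S : Type*} [Ring ι] [Fintype ι] [DecidableEq ι] [CommRing S]
    (Λ : Finset (ℕ × ℕ)) (T : ℕ × ℕ → S) (G : ℕ → ι → S) (r : ℕ) (b a : ι) :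
    (shiftMatrix Λ T G ^ r) b a = wordSum Λ r fun w =>
      if b = a + (shift w : ι) then (w.map T).prod * wordVal G w a else 0 := by
  induction r generalizing b with
  | zero => simp [wordSum, wordVal, Matrix.one_apply]
  | succ r ih =>
    rw [pow_succ', Matrix.mul_apply, wordSum]
    simp only [shiftMatrix, Matrix.of_apply, Finset.sum_mul]
    rw [Finset.sum_comm]
    refine Finset.sum_congr rfl fun x _ => ?_
    have : ∀ c, (shiftMatrix Λ T G ^ r) c a = _ := fun c => ih c
    simp only [shiftMatrix] at this
    simp only [this, mul_wordSum]
    rw [← wordSum_sum]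
    refine wordSum_congr fun w _ _ => ?_
    rw [Finset.sum_eq_single (a + (shift w : ι))]
    · rw [if_pos (show a + (shift w : ι) = a + (shift w : ι) from rfl), shift_cons,
        List.map_cons, List.prod_cons, wordVal, ite_mul, zero_mul]
      refine if_congr ?_ (by ring) rfl
      rw [add_assoc, Int.cast_add, add_comm (shift w : ι)]
    · intro c _ hc
      rw [if_neg hc, mul_zero]
    · simp

/-- A word contributes to the diagonal when its degree vanishes in `ι`. For `ι = ZMod p` this admits
spurious words of nonzero degree divisible by `p`, which have to be excluded separately. -/
theorem trace_shiftMatrix_pow {ι S : Type*} [Ring ι] [Fintype ι] [DecidableEq ι] [CommRing S]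
    (Λ : Finset (ℕ × ℕ)) (T : ℕ × ℕ → S) (G : ℕ → ι → S) (r : ℕ) :
    (shiftMatrix Λ T G ^ r).trace = wordSum Λ r fun w =>
      if (shift w : ι) = 0 then (w.map T).prod * ∑ a, wordVal G w a else 0 := by
  simp only [Matrix.trace, Matrix.diag_apply, shiftMatrix_pow_apply]
  rw [← wordSum_sum]
  refine wordSum_congr fun w _ _ => ?_
  by_cases h : (shift w : ι) = 0
  · simp [h, Finset.mul_sum]
  · simp [h]

/-! ### Regularized traces and determinants, and their base change -/

/-- The falling factorial `c (c - 1) ⋯ (c - j + 1)`. -/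
def falling {C : Type*} [CommRing C] (c : C) (j : ℕ) : C := ∏ u ∈ Finset.range j, (c - (u : C))

theorem map_falling {C C' : Type*} [CommRing C] [CommRing C'] (f : C →+* C') (c : C) (j : ℕ) :
    f (falling c j) = falling (f c) j := by
  simp [falling]

/-- The function `ε / (c + ε)` as a power series in `ε`. -/
def poleFactor (C : Type*) [CommRing C] (c : ℤ) : C⟦X⟧ :=
  if c = 0 then 1 else PowerSeries.X * Ring.inverse ((c : C⟦X⟧) + PowerSeries.X)

/-- The value at `c + ε` of `ε^n z (z - 1) ⋯ (z - j + 1) / ∏ (z - l s)`. -/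
def letterVal {n : ℕ} (l : Fin n → ℤ) (C : Type*) [CommRing C] (j : ℕ) (c : ℤ) : C⟦X⟧ :=
  falling ((c : C⟦X⟧) + PowerSeries.X) j * ∏ s, poleFactor C (c - l s)

theorem isUnit_intCast_add_X {C : Type*} [CommRing C] {c : ℤ} (hc : IsUnit (c : C)) :
    IsUnit ((c : C⟦X⟧) + PowerSeries.X) := by
  rw [PowerSeries.isUnit_iff_constantCoeff]
  simpa using hc

theorem map_poleFactor {C C' : Type*} [CommRing C] [CommRing C'] (f : C →+* C') {c : ℤ}
    (hc : c ≠ 0 → IsUnit (c : C)) :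
    PowerSeries.map f (poleFactor C c) = poleFactor C' c := by
  rw [poleFactor, poleFactor]
  split_ifs with h
  · simp
  · rw [map_mul, map_ringInverse _ (isUnit_intCast_add_X (hc h))]
    simp

/-- A bound for the absolute values of the exponents. -/
def radius {n : ℕ} (l : Fin n → ℤ) : ℕ := ∑ s, (l s).natAbs

theorem abs_le_radius {n : ℕ} (l : Fin n → ℤ) (s : Fin n) : |l s| ≤ radius l := by
  have h : (l s).natAbs ≤ radius l :=
    Finset.single_le_sum (f := fun s => (l s).natAbs) (fun _ _ => Nat.zero_le _) (Finset.mem_univ s)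
  rw [Int.abs_eq_natAbs]
  exact_mod_cast h

theorem map_letterVal {n : ℕ} (l : Fin n → ℤ) {C C' : Type*} [CommRing C] [CommRing C']
    (f : C →+* C') (j : ℕ) {c : ℤ}
    (hc : ∀ s, c - l s ≠ 0 → IsUnit ((c - l s : ℤ) : C)) :
    PowerSeries.map f (letterVal l C j c) = letterVal l C' j c := by
  rw [letterVal, letterVal, map_mul, map_falling, map_prod]
  congr 1
  · simp
  · exact Finset.prod_congr rfl fun s _ => map_poleFactor f (hc s)

/-- The letters `x^i ∂^j` that can occur in a word of length `r` and degree `0`. -/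
def letters (m r : ℕ) : Finset (ℕ × ℕ) := Finset.range (m + m * r + 1) ×ˢ Finset.range (m + 1)

/-- The regularized trace of the word `w`: the sum of the polar parts, in terms of `ε`, of its
value at `q + ε` for integers `q` with `|q| ≤ Q`, multiplied by `ε ^ e`. -/
def polarSum (C : Type*) [CommRing C] {n : ℕ} (l : Fin n → ℤ) (Q e : ℕ) (w : List (ℕ × ℕ)) :
    C⟦X⟧ :=
  ∑ q ∈ Finset.Icc (-(Q : ℤ)) Q,
    ((PowerSeries.trunc e (wordVal (letterVal l C) w q) : Polynomial C) : C⟦X⟧)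

/-- The regularized trace of the `r`-th power of `P(x∂)⁻¹ ∑ T x^i ∂^j`, times `ε ^ (n r)`. -/
def regTrace {C : Type*} [CommRing C] {n : ℕ} (l : Fin n → ℤ) (m : ℕ) (T : ℕ × ℕ → C) (r : ℕ) :
    C⟦X⟧ :=
  wordSum (letters m r) r fun w =>
    if shift w = 0 then
      PowerSeries.C (w.map T).prod * polarSum C l (radius l + m * r) (n * r) w
    else 0

/-- The term of degree `k` of the regularized determinant. -/
def regDet {C : Type*} [CommRing C] {n : ℕ} (l : Fin n → ℤ) (m : ℕ) (T : ℕ × ℕ → C) (k : ℕ) : C :=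
  PowerSeries.coeff (n * k) ((-PowerSeries.X) ^ n * newton (regTrace l m T) k)

/-- All nonzero integers of absolute value at most `B` are invertible in `C`. -/
def SmallUnits (C : Type*) [CommRing C] (B : ℕ) : Prop :=
  ∀ c : ℤ, c ≠ 0 → |c| ≤ B → IsUnit (c : C)

theorem SmallUnits.mono {C : Type*} [CommRing C] {B B' : ℕ} (h : SmallUnits C B) (hB : B' ≤ B) :
    SmallUnits C B' := fun c hc hc' => h c hc (hc'.trans (by exact_mod_cast hB))

theorem SmallUnits.natCast {C : Type*} [CommRing C] {B : ℕ} (h : SmallUnits C B) (i : ℕ)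
    (h1 : 1 ≤ i) (h2 : i ≤ B) : IsUnit (i : C) := by
  have := h i (by omega) (by rw [Nat.abs_cast]; exact_mod_cast h2)
  simpa using this

theorem mem_letters {m r : ℕ} {x : ℕ × ℕ} :
    x ∈ letters m r ↔ x.1 ≤ m + m * r ∧ x.2 ≤ m := by
  simp only [letters, Finset.mem_product, Finset.mem_range]
  omega

/-- The integers inverted are of the form `q + shift v - l s`. The bound adds `radius l + m * r` for
`q`, `m * r` for the suffix and `radius l` for the root. -/
theorem map_polarSum {C C' : Type*} [CommRing C] [CommRing C'] (f : C →+* C') {n : ℕ}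
    (l : Fin n → ℤ) {m r : ℕ} (hC : SmallUnits C (2 * radius l + 2 * m * r)) (e : ℕ)
    {w : List (ℕ × ℕ)} (hw : ∀ x ∈ w, x.2 ≤ m) (h0 : shift w = 0) (hr : w.length = r) :
    PowerSeries.map f (polarSum C l (radius l + m * r) e w) =
      polarSum C' l (radius l + m * r) e w := by
  rw [polarSum, polarSum, map_sum]
  refine Finset.sum_congr rfl fun q hq => ?_
  rw [← map_wordVal (PowerSeries.map f) (G := letterVal l C) w (a := q) (a' := q)]
  · ext i
    rw [PowerSeries.coeff_map, Polynomial.coeff_coe, Polynomial.coeff_coe, PowerSeries.coeff_trunc,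
      PowerSeries.coeff_trunc, PowerSeries.coeff_map]
    split_ifs <;> simp
  · intro v hv j
    refine map_letterVal l f j fun s hs => hC _ hs ?_
    have h1 := abs_shift_suffix_le hw h0 hv
    rw [hr] at h1
    have h2 := abs_le_radius l s
    have h3 := Finset.mem_Icc.mp hq
    rw [abs_le] at h1 h2 ⊢
    push_cast at h3 ⊢
    constructor <;> linarith [h1.1, h1.2]

theorem map_regTrace {C C' : Type*} [CommRing C] [CommRing C'] (f : C →+* C') {n : ℕ}
    (l : Fin n → ℤ) (m : ℕ) (T : ℕ × ℕ → C) {r : ℕ}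
    (hC : SmallUnits C (2 * radius l + 2 * m * r)) :
    PowerSeries.map f (regTrace l m T r) = regTrace l m (fun x => f (T x)) r := by
  rw [regTrace, regTrace, map_wordSum]
  refine wordSum_congr fun w hw hw' => ?_
  split_ifs with h0
  · rw [map_mul, map_polarSum f l hC _ (fun x hx => (mem_letters.mp (hw' x hx)).2) h0 hw,
      PowerSeries.map_C, map_list_prod, List.map_map]
    rfl
  · simp

/-- The bound covers both the pole factors of words of length at most `k` and the divisions by `1,
…, k` in Newton's recursion. -/
theorem map_regDet {C C' : Type*} [CommRing C] [CommRing C'] (f : C →+* C') {n : ℕ}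
    (l : Fin n → ℤ) (m : ℕ) (T : ℕ × ℕ → C) {k : ℕ}
    (hC : SmallUnits C (2 * radius l + (2 * m + 1) * k)) :
    f (regDet l m T k) = regDet l m (fun x => f (T x)) k := by
  rw [regDet, regDet, ← PowerSeries.coeff_map, map_mul, map_pow, map_neg, PowerSeries.map_X,
    map_newton (PowerSeries.map f) (regTrace l m T) (k := k) _ k le_rfl]
  · congr 2
    refine newton_congr (k := k) (fun i _ hi => ?_) k le_rfl
    refine map_regTrace f l m T (hC.mono ?_)
    nlinarith
  · intro i h1 h2
    have := (hC.natCast i h1 (by nlinarith)).map (PowerSeries.C (R := C))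
    simpa using this

/-- Raising the degree of each letter by `m` makes the exponent of `z` a natural number. -/
theorem prod_map_rescale {C : Type*} [CommRing C] {m : ℕ} (T : ℕ × ℕ → C) (z : C)
    (w : List (ℕ × ℕ)) (hw : ∀ x ∈ w, x.2 ≤ m) :
    ∃ e : ℕ, (e : ℤ) = shift w + m * w.length ∧
      (w.map fun x => z ^ (x.1 + (m - x.2)) * T x).prod = z ^ e * (w.map T).prod := by
  induction w with
  | nil => exact ⟨0, by simp, by simp⟩
  | cons x w ih =>
    obtain ⟨e, he, he'⟩ := ih fun y hy => hw y (by simp [hy])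
    refine ⟨x.1 + (m - x.2) + e, ?_, ?_⟩
    · have := hw x (by simp)
      rw [shift_cons, List.length_cons]
      push_cast [Nat.cast_sub this]
      linarith
    · rw [List.map_cons, List.map_cons, List.prod_cons, List.prod_cons, he', pow_add _ _ e]
      ring

/-- Regularized determinants are homogeneous with respect to rescaling `x`. -/
theorem regDet_rescale {C : Type*} [CommRing C] {n : ℕ} (l : Fin n → ℤ) (m : ℕ)
    (T : ℕ × ℕ → C) (z : C) (k : ℕ) :
    regDet l m (fun x => z ^ (x.1 + (m - x.2)) * T x) k = z ^ (m * k) * regDet l m T k := by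
  have htr : ∀ r, regTrace l m (fun x => z ^ (x.1 + (m - x.2)) * T x) r =
      PowerSeries.C (z ^ m) ^ r * regTrace l m T r := by
    intro r
    rw [regTrace, regTrace, mul_wordSum]
    refine wordSum_congr fun w hw hw' => ?_
    split_ifs with h0
    · obtain ⟨e, he, he'⟩ := prod_map_rescale T z w fun x hx => (mem_letters.mp (hw' x hx)).2
      rw [h0, hw, zero_add] at he
      have : e = m * r := by exact_mod_cast he
      rw [he', this, map_mul, mul_assoc, pow_mul, map_pow]
    · simp
  rw [regDet, regDet, newton_congr (k := k) (fun i _ _ => htr i) k le_rfl, newton_homogeneous,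
    mul_left_comm, ← map_pow, PowerSeries.coeff_C_mul, pow_mul]

/-! ### Partial fractions over a field -/

section Field

variable {F : Type*} [Field F]

open Classical in
/-- The function `ε / (a + ε)` as a power series in `ε`, for `a` in a field. -/
def pole (a : F) : F⟦X⟧ :=
  if a = 0 then 1 else PowerSeries.X * Ring.inverse (PowerSeries.C a + PowerSeries.X)

theorem C_add_X_isUnit {a : F} (ha : a ≠ 0) : IsUnit (PowerSeries.C a + PowerSeries.X : F⟦X⟧) := by
  rw [PowerSeries.isUnit_iff_constantCoeff]
  simpa using ha

theorem add_X_mul_pole (a : F) :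
    (PowerSeries.C a + PowerSeries.X) * pole a = (PowerSeries.X : F⟦X⟧) := by
  rw [pole]
  split_ifs with h
  · simp [h]
  · rw [mul_left_comm, Ring.mul_inverse_cancel _ (C_add_X_isUnit h), mul_one]

/-- The partial fraction identity for two simple poles, with denominators cleared. -/
theorem pole_mul_pole (a b : F) :
    PowerSeries.C (a - b) * (pole a * pole b) = PowerSeries.X * pole b - PowerSeries.X * pole a := by
  have h1 := add_X_mul_pole a
  have h2 := add_X_mul_pole b
  rw [map_sub]
  linear_combination pole b * h1 - pole a * h2

/-- Expand `(a + ε)^(-k)` by rescaling `(1 + ε)^(-k)`. At `a = 0` both sides vanish, as `0⁻¹ = 0`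
and the exponent is positive, so the formula can be summed over the whole field. -/
theorem coeff_X_pow_mul_pole_pow {e k r : ℕ} (hk : 1 ≤ k) (hke : k ≤ e) (hr : e ≤ r) (a : F) :
    PowerSeries.coeff r (PowerSeries.X ^ (e - k) * pole a ^ k) =
      a⁻¹ ^ (k + (r - e)) *
        PowerSeries.coeff (r - e)
          (Ring.inverse (PowerSeries.C 1 + PowerSeries.X : F⟦X⟧) ^ k) := by
  by_cases ha : a = 0
  · rw [pole, if_pos ha, one_pow, mul_one, PowerSeries.coeff_X_pow, if_neg (by omega), ha, inv_zero,
      zero_pow (by omega), zero_mul]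
  · have h1 : Ring.inverse (PowerSeries.C a + PowerSeries.X : F⟦X⟧) =
        PowerSeries.C a⁻¹ *
          PowerSeries.rescale a⁻¹ (Ring.inverse (PowerSeries.C 1 + PowerSeries.X : F⟦X⟧)) := by
      have hu := C_add_X_isUnit (one_ne_zero (α := F))
      rw [← mul_one (Ring.inverse _), Ring.inverse_mul_eq_iff_eq_mul _ _ _ (C_add_X_isUnit ha)]
      have h2 : (PowerSeries.C a + PowerSeries.X : F⟦X⟧) =
          PowerSeries.C a * PowerSeries.rescale a⁻¹ (PowerSeries.C 1 + PowerSeries.X) := by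
        rw [map_add, PowerSeries.rescale_X, mul_add, ← mul_assoc, ← map_mul, mul_inv_cancel₀ ha,
          map_one, one_mul]
        simp
      rw [h2, mul_mul_mul_comm, ← map_mul, ← map_mul, mul_inv_cancel₀ ha,
        Ring.mul_inverse_cancel _ hu, map_one, map_one, one_mul]
    rw [pole, if_neg ha, mul_pow, ← mul_assoc, ← pow_add, Nat.sub_add_cancel hke,
      PowerSeries.coeff_X_pow_mul', if_pos hr, h1, mul_pow, ← map_pow, PowerSeries.coeff_C_mul,
      ← map_pow, PowerSeries.coeff_rescale, pow_add, mul_assoc]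

/-- The functions `ε ^ e f(a + ε)`, where `f` is a rational function with poles in `F` of order at
most `e` whose polynomial part has degree at most `D`. -/
def ratFun (F : Type*) [Field F] (e D : ℕ) : Submodule F (F → F⟦X⟧) :=
  Submodule.span F
    ({f | ∃ k ≤ D, f = fun a => PowerSeries.X ^ e * (PowerSeries.C a + PowerSeries.X) ^ k} ∪
      {f | ∃ q : F, ∃ k, 1 ≤ k ∧ k ≤ e ∧
        f = fun a => PowerSeries.X ^ (e - k) * pole (a - q) ^ k})

theorem ratFun_poly {e D k : ℕ} (hk : k ≤ D) :
    (fun a => PowerSeries.X ^ e * (PowerSeries.C a + PowerSeries.X) ^ k) ∈ ratFun F e D :=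
  Submodule.subset_span (Or.inl ⟨k, hk, rfl⟩)

theorem ratFun_pole {e D k : ℕ} (q : F) (h1 : 1 ≤ k) (hk : k ≤ e) :
    (fun a => PowerSeries.X ^ (e - k) * pole (a - q) ^ k) ∈ ratFun F e D :=
  Submodule.subset_span (Or.inr ⟨q, k, h1, hk, rfl⟩)

theorem ratFun_mono {e D D' : ℕ} (h : D ≤ D') : ratFun F e D ≤ ratFun F e D' := by
  refine Submodule.span_le.mpr ?_
  rintro f (⟨k, hk, rfl⟩ | ⟨q, k, h1, h2, rfl⟩)
  · exact ratFun_poly (hk.trans h)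
  · exact ratFun_pole q h1 h2

theorem ratFun_mul {e D e' D' : ℕ} (g : F → F⟦X⟧)
    (hpoly : ∀ k ≤ D, (fun a => g a * (PowerSeries.X ^ e * (PowerSeries.C a + PowerSeries.X) ^ k)) ∈
      ratFun F e' D')
    (hpole : ∀ (q : F) (k : ℕ), 1 ≤ k → k ≤ e →
      (fun a => g a * (PowerSeries.X ^ (e - k) * pole (a - q) ^ k)) ∈ ratFun F e' D')
    {f : F → F⟦X⟧} (hf : f ∈ ratFun F e D) : (fun a => g a * f a) ∈ ratFun F e' D' := by
  have : ratFun F e D ≤ (ratFun F e' D').comap (LinearMap.mulLeft F g) := by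
    refine Submodule.span_le.mpr ?_
    rintro f (⟨k, hk, rfl⟩ | ⟨q, k, h1, h2, rfl⟩)
    · exact hpoly k hk
    · exact hpole q k h1 h2
  exact this hf

/-- Write `a + ε = (a - q + ε) + q`: the first summand lowers the order of the pole at `q` by one.
-/
theorem ratFun_mul_linear {e D : ℕ} (c : F) {f : F → F⟦X⟧} (hf : f ∈ ratFun F e D) :
    (fun a => (PowerSeries.C (a + c) + PowerSeries.X) * f a) ∈ ratFun F e (D + 1) := by
  have h1 : (fun a => (PowerSeries.C a + PowerSeries.X) * f a) ∈ ratFun F e (D + 1) := by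
    refine ratFun_mul _ (fun k hk => ?_) (fun q k h1 h2 => ?_) hf
    · convert ratFun_poly (F := F) (e := e) (show k + 1 ≤ D + 1 by omega) using 2 with a
      ring
    · have h3 : (fun a => PowerSeries.X ^ (e - (k - 1)) * pole (a - q) ^ (k - 1)) ∈
          ratFun F e (D + 1) := by
        rcases Nat.eq_or_lt_of_le h1 with h | h
        · rw [← h]
          simpa using ratFun_poly (F := F) (e := e) (show 0 ≤ D + 1 by omega)
        · exact ratFun_pole q (by omega) (by omega)
      convert add_mem h3 ((ratFun F e (D + 1)).smul_mem q (ratFun_pole q h1 h2)) using 1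
      funext a
      have h4 := add_X_mul_pole (a - q)
      obtain ⟨k, rfl⟩ := Nat.exists_eq_add_of_le' h1
      have h5 : e - k = (e - (k + 1)) + 1 := by omega
      simp only [Pi.add_apply, Pi.smul_apply, PowerSeries.smul_eq_C_mul, Nat.add_sub_cancel, h5]
      rw [map_sub] at h4
      linear_combination (PowerSeries.X ^ (e - (k + 1)) * pole (a - q) ^ k) * h4
  convert add_mem h1 ((ratFun F e (D + 1)).smul_mem c (ratFun_mono (Nat.le_succ D) hf)) using 1
  funext a
  simp only [Pi.add_apply, Pi.smul_apply, PowerSeries.smul_eq_C_mul, map_add]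
  ring

/-- Against a polynomial, `a + ε` is split as above; against a pole at another point,
`pole_mul_pole` lowers the order by one. -/
theorem ratFun_mul_pole {e D : ℕ} (q : F) {f : F → F⟦X⟧} (hf : f ∈ ratFun F e D) :
    (fun a => pole (a - q) * f a) ∈ ratFun F (e + 1) D := by
  refine ratFun_mul _ (fun k => ?_) (fun q' k => ?_) hf
  · induction k with
    | zero =>
      intro _
      convert ratFun_pole (F := F) (e := e + 1) (D := D) q le_rfl (by omega) using 2 with a
      simp only [Nat.add_sub_cancel]
      ring
    | succ k ih =>
      intro hk
      convert add_mem (ratFun_poly (F := F) (e := e + 1) (show k ≤ D by omega))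
        ((ratFun F (e + 1) D).smul_mem q (ih (by omega))) using 1
      funext a
      have h4 := add_X_mul_pole (a - q)
      simp only [Pi.add_apply, Pi.smul_apply, PowerSeries.smul_eq_C_mul]
      rw [map_sub] at h4
      linear_combination (PowerSeries.X ^ e * (PowerSeries.C a + PowerSeries.X) ^ k) * h4
  · by_cases hq : q' = q
    · intro h1 h2
      subst hq
      convert ratFun_pole (F := F) (e := e + 1) (D := D) q' (show 1 ≤ k + 1 by omega) (by omega)
        using 2 with a
      rw [Nat.add_sub_add_right]
      ring
    · induction k with
      | zero => omega
      | succ k ih =>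
        intro _ h2
        have h3 : (fun a => pole (a - q) * (PowerSeries.X ^ (e - k) * pole (a - q') ^ k)) ∈
            ratFun F (e + 1) D := by
          rcases Nat.eq_zero_or_pos k with rfl | hk
          · simpa [mul_comm] using
              ratFun_pole (F := F) (e := e + 1) (D := D) q le_rfl (by omega)
          · exact ih hk (by omega)
        have h4 := ratFun_pole (F := F) (e := e + 1) (D := D) q' (show 1 ≤ k + 1 by omega) (by omega)
        convert (ratFun F (e + 1) D).smul_mem (q' - q)⁻¹ (sub_mem h4 h3) using 1
        funext a
        have h5 := pole_mul_pole (a - q) (a - q')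
        rw [show a - q - (a - q') = q' - q by ring] at h5
        have h6 : PowerSeries.C (q' - q)⁻¹ * PowerSeries.C (q' - q) = (1 : F⟦X⟧) := by
          rw [← map_mul, inv_mul_cancel₀ (sub_ne_zero.mpr hq), map_one]
        have h7 : e + 1 - (k + 1) = e - (k + 1) + 1 := by omega
        have h8 : e - k = e - (k + 1) + 1 := by omega
        simp only [Pi.smul_apply, Pi.sub_apply, PowerSeries.smul_eq_C_mul, h7, h8]
        linear_combination
          (PowerSeries.C (q' - q)⁻¹ * PowerSeries.X ^ (e - (k + 1)) * pole (a - q') ^ k) * h5 -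
          (pole (a - q) * PowerSeries.X ^ (e - (k + 1)) * pole (a - q') ^ (k + 1)) * h6

theorem ratFun_mul_falling {e D : ℕ} (c : F) (j : ℕ) {f : F → F⟦X⟧} (hf : f ∈ ratFun F e D) :
    (fun a => falling (PowerSeries.C (a + c) + PowerSeries.X) j * f a) ∈ ratFun F e (D + j) := by
  induction j with
  | zero => simpa [falling] using hf
  | succ j ih =>
    have h := ratFun_mul_linear (c - j) ih
    rw [← add_assoc]
    convert h using 1
    funext a
    simp only [falling, Finset.prod_range_succ, map_add, map_sub, map_natCast]
    ring

theorem ratFun_mul_prod_pole {κ : Type*} {e D : ℕ} (s : Finset κ) (q : κ → F) {f : F → F⟦X⟧}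
    (hf : f ∈ ratFun F e D) :
    (fun a => (∏ i ∈ s, pole (a - q i)) * f a) ∈ ratFun F (e + s.card) D := by
  classical
  induction s using Finset.induction_on with
  | empty => simpa using hf
  | insert i s hi ih =>
    rw [Finset.card_insert_of_notMem hi, ← add_assoc]
    convert ratFun_mul_pole (q i) ih using 2 with a
    rw [Finset.prod_insert hi, mul_assoc]

/-- The value of a letter at `a + ε`, for `a` in a field. -/
def letterValField {n : ℕ} (l : Fin n → ℤ) (j : ℕ) (a : F) : F⟦X⟧ :=
  falling (PowerSeries.C a + PowerSeries.X) j * ∏ s, pole (a - (l s : F))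

/-- Each letter contributes `n` poles and a numerator of degree at most `m`. -/
theorem wordVal_mem_ratFun {n : ℕ} (l : Fin n → ℤ) {m : ℕ} (w : List (ℕ × ℕ))
    (hw : ∀ x ∈ w, x.2 ≤ m) :
    wordVal (letterValField (F := F) l) w ∈ ratFun F (n * w.length) (m * w.length) := by
  induction w with
  | nil =>
    have h : wordVal (letterValField (F := F) l) [] = fun a =>
        PowerSeries.X ^ 0 * (PowerSeries.C a + PowerSeries.X) ^ 0 := by
      funext a
      simp [wordVal]
    rw [h]
    exact ratFun_poly (le_refl 0)
  | cons x w ih =>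
    have h1 := ratFun_mul_falling (shift w : F) x.2 (ratFun_mul_prod_pole Finset.univ
      (fun s => (l s : F) - (shift w : F)) (ih fun y hy => hw y (by simp [hy])))
    rw [Finset.card_univ, Fintype.card_fin] at h1
    have h2 := hw x (by simp)
    rw [List.length_cons, Nat.mul_succ]
    convert ratFun_mono (show m * w.length + x.2 ≤ m * (w.length + 1) by
      rw [Nat.mul_succ]; omega) h1 using 2 with a
    rw [wordVal, letterValField, mul_assoc]
    congr 2
    refine Finset.prod_congr rfl fun s _ => ?_
    congr 1
    ring

end Field

/-! ### Sums of rational functions over `ZMod p` -/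

section Prime

variable {p : ℕ} [Fact p.Prime]

theorem sum_pow_eq_zero {k : ℕ} (hk : k < p - 1) : ∑ a : ZMod p, a ^ k = 0 :=
  FiniteField.sum_pow_lt_card_sub_one (ZMod p) k (by rwa [ZMod.card])

/-- Power sums of exponent below `p - 1` vanish. This kills the polynomial part; from order `e` on,
a polar term has as coefficient a multiple of a power of `(a - q)⁻¹` with exponent at most `i`, and
`a ↦ a⁻¹` permutes the field. -/
theorem coeff_sum_ratFun {e D i : ℕ} (hD : D < p - 1) (he : e ≤ i) (hi : i < p - 1)
    {f : ZMod p → (ZMod p)⟦X⟧} (hf : f ∈ ratFun (ZMod p) e D) :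
    PowerSeries.coeff i (∑ a, f a) = 0 := by
  let Φ : (ZMod p → (ZMod p)⟦X⟧) →ₗ[ZMod p] ZMod p :=
    PowerSeries.coeff i ∘ₗ ∑ a : ZMod p, LinearMap.proj a
  have hΦ : ∀ f, Φ f = PowerSeries.coeff i (∑ a, f a) := fun f => by simp [Φ]
  have : ratFun (ZMod p) e D ≤ LinearMap.ker Φ := by
    refine Submodule.span_le.mpr ?_
    rintro f (⟨k, hk, rfl⟩ | ⟨q, k, h1, h2, rfl⟩)
    · rw [SetLike.mem_coe, LinearMap.mem_ker, hΦ, ← Finset.mul_sum]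
      have h3 : ∑ a : ZMod p, (PowerSeries.C a + PowerSeries.X : (ZMod p)⟦X⟧) ^ k = 0 := by
        simp only [add_pow]
        rw [Finset.sum_comm]
        refine Finset.sum_eq_zero fun j hj => ?_
        have := Finset.mem_range.mp hj
        simp only [← map_pow]
        rw [← Finset.sum_mul, ← Finset.sum_mul, ← map_sum, sum_pow_eq_zero (by omega)]
        simp
      rw [h3, mul_zero, map_zero]
    · rw [SetLike.mem_coe, LinearMap.mem_ker, hΦ, map_sum,
        ← Equiv.sum_comp (Equiv.addRight q)]
      simp only [Equiv.coe_addRight, add_sub_cancel_right, coeff_X_pow_mul_pole_pow h1 h2 he]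
      rw [← Finset.sum_mul, ← Equiv.sum_comp (Equiv.inv (ZMod p))]
      simp only [Equiv.inv_apply, inv_inv]
      rw [sum_pow_eq_zero (by omega), zero_mul]
  rw [← hΦ]
  exact this hf

theorem pole_intCast {c : ℤ} (hc : |c| < p) : pole (c : ZMod p) = poleFactor (ZMod p) c := by
  have h : (c : ZMod p) = 0 ↔ c = 0 := by
    rw [ZMod.intCast_zmod_eq_zero_iff_dvd]
    exact ⟨fun h => Int.eq_zero_of_abs_lt_dvd h hc, fun h => h ▸ dvd_zero _⟩
  rw [pole, poleFactor]
  split_ifs with h1 h2 h2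
  · rfl
  · exact absurd (h.mp h1) h2
  · exact absurd (h.mpr h2) h1
  · simp

/-- The sum over `ZMod p` of the values of a word at `a + ε` agrees, up to order `p - 2`, with the
sum of the polar parts. -/
theorem coeff_sum_wordVal {n : ℕ} (l : Fin n → ℤ) {m : ℕ} {w : List (ℕ × ℕ)}
    (hw : ∀ x ∈ w, x.2 ≤ m) (h0 : shift w = 0)
    (hp : 2 * radius l + (2 * m + n) * w.length + 1 < p) {i : ℕ} (hi : i < p - 1) :
    PowerSeries.coeff i (∑ a : ZMod p, wordVal (letterValField l) w a) =
      PowerSeries.coeff i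
        (polarSum (ZMod p) l (radius l + m * w.length) (n * w.length) w) := by
  rw [add_mul, mul_assoc] at hp
  rw [polarSum, map_sum (PowerSeries.coeff i) _ (Finset.Icc _ _)]
  simp only [Polynomial.coeff_coe, PowerSeries.coeff_trunc]
  by_cases hin : i < n * w.length
  · simp only [if_pos hin, map_sum]
    -- Unless the orbit of `a` meets some root `l s`, every pole factor is divisible by `ε`, and the
    -- value starts in order `n * w.length`.
    have hvan : ∀ a : ZMod p, PowerSeries.coeff i (wordVal (letterValField l) w a) ≠ 0 →
        ∃ q ∈ Finset.Icc (-((radius l + m * w.length : ℕ) : ℤ)) (radius l + m * w.length : ℕ),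
          (q : ZMod p) = a := by
      intro a ha
      by_contra hcon
      refine ha ?_
      have hsuf : ∀ v, v <:+ w →
          (PowerSeries.X : (ZMod p)⟦X⟧) ^ (n * v.length) ∣ wordVal (letterValField l) v a := by
        intro v
        induction v with
        | nil => simp
        | cons x v ih =>
          intro hv
          have hv' : v <:+ w := (List.suffix_cons x v).trans hv
          rw [wordVal, List.length_cons, Nat.mul_succ, add_comm, pow_add, letterValField]
          refine mul_dvd_mul (Dvd.dvd.mul_left ?_ _) (ih hv')
          have h1 : ∀ s : Fin n, (PowerSeries.X : (ZMod p)⟦X⟧) ∣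
              pole (a + (shift v : ZMod p) - (l s : ZMod p)) := by
            intro s
            rw [pole, if_neg]
            · exact Dvd.intro _ rfl
            · intro h2
              refine hcon ⟨l s - shift v, ?_, ?_⟩
              · have h3 := abs_shift_suffix_le hw h0 hv'
                have h4 := abs_le_radius l s
                rw [abs_le] at h3 h4
                rw [Finset.mem_Icc]
                push_cast
                constructor <;> linarith [h3.1, h3.2, h4.1, h4.2]
              · push_cast
                linear_combination -h2
          have h2 := Finset.prod_dvd_prod_of_dvd (fun _ : Fin n => (PowerSeries.X : (ZMod p)⟦X⟧)) _
            fun s (_ : s ∈ Finset.univ) => h1 s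
          simpa using h2
      exact PowerSeries.X_pow_dvd_iff.mp (hsuf w List.suffix_rfl) i hin
    -- The window has diameter `2 * (radius l + m * w.length) < p`, so no residue class is counted
    -- twice.
    have hinj : Set.InjOn (fun q : ℤ => (q : ZMod p))
        (Finset.Icc (-((radius l + m * w.length : ℕ) : ℤ)) (radius l + m * w.length : ℕ)) := by
      intro q hq q' hq' h
      rw [Finset.mem_coe, Finset.mem_Icc] at hq hq'
      have h1 : ((q - q' : ℤ) : ZMod p) = 0 := by
        push_cast
        exact sub_eq_zero.mpr h
      rw [ZMod.intCast_zmod_eq_zero_iff_dvd] at h1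
      refine sub_eq_zero.mp (Int.eq_zero_of_abs_lt_dvd h1 ?_)
      rw [abs_lt]
      push_cast at hq hq'
      zify at hp
      have : (0 : ℤ) ≤ n * w.length := by positivity
      constructor <;> linarith [hq.1, hq.2, hq'.1, hq'.2]
    rw [← Finset.sum_subset (Finset.subset_univ
      ((Finset.Icc (-((radius l + m * w.length : ℕ) : ℤ)) (radius l + m * w.length : ℕ)).image
        fun q : ℤ => (q : ZMod p))), Finset.sum_image hinj]
    · refine Finset.sum_congr rfl fun q hq => ?_
      congr 1
      refine map_wordVal (RingHom.id _) w fun v hv j => ?_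
      rw [RingHom.id_apply, letterValField, letterVal]
      have h3 := abs_shift_suffix_le hw h0 hv
      rw [Finset.mem_Icc] at hq
      congr 1
      · simp
      · refine Finset.prod_congr rfl fun s _ => ?_
        have h4 := abs_le_radius l s
        rw [← pole_intCast]
        · push_cast
          rfl
        · rw [abs_le] at h3 h4
          rw [abs_lt]
          push_cast at hq
          zify at hp
          have : (0 : ℤ) ≤ n * w.length := by positivity
          simp only [Int.cast_id]
          constructor <;> linarith [h3.1, h3.2, h4.1, h4.2, hq.1, hq.2]
    · intro a _ ha
      by_contra h
      obtain ⟨q, hq, hqa⟩ := hvan a h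
      exact ha (Finset.mem_image.mpr ⟨q, hq, hqa⟩)
  · simp only [if_neg hin, Finset.sum_const_zero]
    refine coeff_sum_ratFun ?_ (not_lt.mp hin) hi (wordVal_mem_ratFun l w hw)
    have : m * w.length ≤ 2 * (m * w.length) := by omega
    omega

end Prime

/-! ### Determinants of pencils and the cyclic determinant -/

/-- The polynomial `det (diag P + sK)` in `s`. -/
def pencil {ι S : Type*} [Fintype ι] [DecidableEq ι] [CommRing S] (P : ι → S)
    (K : Matrix ι ι S) : Polynomial S :=
  (Matrix.of fun b a =>
    (if b = a then Polynomial.C (P a) else 0) + Polynomial.X * Polynomial.C (K b a)).det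

theorem map_pencil {ι S S' : Type*} [Fintype ι] [DecidableEq ι] [CommRing S] [CommRing S']
    (f : S →+* S') (P : ι → S) (K : Matrix ι ι S) :
    (pencil P K).map f = pencil (fun a => f (P a)) (K.map f) := by
  rw [pencil, pencil, ← Polynomial.coe_mapRingHom, RingHom.map_det]
  refine congrArg Matrix.det ?_
  ext1 b a
  by_cases h : b = a <;> simp [h]

theorem fredholm_eq_pencil {ι S : Type*} [Fintype ι] [DecidableEq ι] [CommRing S]
    (K : Matrix ι ι S) : fredholm K = pencil (fun _ => 1) K := by
  rw [fredholm, pencil]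
  refine congrArg Matrix.det ?_
  ext1 b a
  by_cases h : b = a <;> simp [h]

theorem coeff_pencil_mul {ι S : Type*} [Fintype ι] [DecidableEq ι] [CommRing S] (c : S) (P : ι → S)
    (K : Matrix ι ι S) (k : ℕ) :
    (pencil P (Matrix.of fun b a => c * K b a)).coeff k = (pencil P K).coeff k * c ^ k := by
  rw [← Polynomial.comp_C_mul_X_coeff, ← Polynomial.coe_compRingHom_apply, pencil, pencil,
    RingHom.map_det]
  congr 2
  ext1 b a
  simp only [Matrix.of_apply, RingHom.mapMatrix_apply, Matrix.map_apply,
    Polynomial.coe_compRingHom_apply]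
  by_cases h : b = a
  · simp [h]
    ring
  · simp [h]
    ring

/-- Factor out `diag P`. With `V = c / P` all entries stay in the ring; for `c = ε^n` this avoids
Laurent series. -/
theorem pencil_eq_fredholm {ι S : Type*} [Fintype ι] [DecidableEq ι] [CommRing S] {c : S}
    {P V : ι → S} (hV : ∀ a, P a * V a = c) (K : Matrix ι ι S) :
    pencil P (Matrix.of fun b a => c * K b a) =
      Polynomial.C (∏ a, P a) * fredholm (Matrix.of fun b a => K b a * V a) := by
  have h : (Polynomial.C (∏ a, P a) : Polynomial S) =
      (Matrix.diagonal fun a => Polynomial.C (P a)).det := by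
    rw [Matrix.det_diagonal, map_prod]
  rw [h, mul_comm, fredholm_eq_pencil, pencil, pencil, ← Matrix.det_mul]
  congr 1
  ext1 b a
  rw [Matrix.mul_diagonal]
  simp only [Matrix.of_apply, ← hV a, map_mul]
  by_cases h : b = a
  · simp [h]
    ring
  · simp [h]
    ring

theorem shiftMatrix_mul {ι S : Type*} [Ring ι] [DecidableEq ι] [CommRing S]
    (Λ : Finset (ℕ × ℕ)) (T : ℕ × ℕ → S) (G : ℕ → ι → S) (V : ι → S) :
    (Matrix.of fun b a => shiftMatrix Λ T G b a * V a) =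
      shiftMatrix Λ T fun j a => G j a * V a := by
  ext b a
  simp only [shiftMatrix, Matrix.of_apply, Finset.sum_mul]
  refine Finset.sum_congr rfl fun x _ => ?_
  split_ifs
  · ring
  · ring

theorem map_shiftMatrix {ι S S' : Type*} [Ring ι] [DecidableEq ι] [CommRing S] [CommRing S']
    (f : S →+* S') (Λ : Finset (ℕ × ℕ)) (T : ℕ × ℕ → S) (G : ℕ → ι → S) :
    (shiftMatrix Λ T G).map f = shiftMatrix Λ (fun x => f (T x)) fun j a => f (G j a) := by
  ext b a
  simp only [shiftMatrix, Matrix.of_apply, Matrix.map_apply, map_sum]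
  refine Finset.sum_congr rfl fun x _ => ?_
  split_ifs <;> simp

theorem le_shift_of_mem {m : ℕ} {w : List (ℕ × ℕ)} (hw : ∀ x ∈ w, x.2 ≤ m) {x : ℕ × ℕ}
    (hx : x ∈ w) : (x.1 : ℤ) - m * w.length ≤ shift w := by
  induction w with
  | nil => simp at hx
  | cons y w ih =>
    have h1 : (y.2 : ℤ) ≤ m := by exact_mod_cast hw y (by simp)
    have hw' : ∀ x ∈ w, x.2 ≤ m := fun z hz => hw z (by simp [hz])
    rw [shift_cons, List.length_cons]
    push_cast
    rcases List.mem_cons.mp hx with rfl | hx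
    · have h2 := neg_le_shift w hw'
      linarith
    · have h2 := ih hw' hx
      have h3 : (0 : ℤ) ≤ y.1 := by positivity
      linarith

/-- The other letters cannot compensate a large exponent of `x`, so a finite alphabet independent of
`p` suffices for the traces. -/
theorem mem_letters_of_shift_eq_zero {m : ℕ} {w : List (ℕ × ℕ)} (hw : ∀ x ∈ w, x.2 ≤ m)
    (h0 : shift w = 0) {x : ℕ × ℕ} (hx : x ∈ w) : x ∈ letters m w.length := by
  have h1 := le_shift_of_mem hw hx
  rw [h0] at h1
  have h2 : (x.1 : ℤ) ≤ (m * w.length : ℕ) := by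
    push_cast
    linarith
  have h3 : x.1 ≤ m * w.length := by exact_mod_cast h2
  exact mem_letters.mpr ⟨by omega, hw x hx⟩

section Prime

variable {p : ℕ} [Fact p.Prime]

/-- This is the factorization of `X^p - X` over `ZMod p`, after `a ↦ -a`. -/
theorem prod_C_add_X :
    ∏ a : ZMod p, (PowerSeries.C a + PowerSeries.X : (ZMod p)⟦X⟧) =
      PowerSeries.X ^ p - PowerSeries.X := by
  have hp : 1 < p := (Fact.out : p.Prime).one_lt
  have hr := FiniteField.roots_X_pow_card_sub_X (ZMod p)
  rw [ZMod.card] at hr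
  have h1 := Polynomial.prod_multiset_X_sub_C_of_monic_of_roots_card_eq
    (p := (Polynomial.X ^ p - Polynomial.X : Polynomial (ZMod p)))
    (Polynomial.monic_X_pow_sub (by rw [Polynomial.degree_X]; exact_mod_cast hp)) (by
      rw [hr, FiniteField.X_pow_card_sub_X_natDegree_eq _ hp]
      exact ZMod.card p)
  rw [hr] at h1
  have h2 : ∏ a : ZMod p, (Polynomial.X - Polynomial.C a : Polynomial (ZMod p)) =
      Polynomial.X ^ p - Polynomial.X := h1
  rw [← Equiv.prod_comp (Equiv.neg (ZMod p))] at h2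
  have h3 := congrArg (Polynomial.coeToPowerSeries.ringHom (R := ZMod p)) h2
  rw [map_prod] at h3
  simp only [Equiv.neg_apply, Polynomial.coeToPowerSeries.ringHom_apply, Polynomial.coe_sub,
    Polynomial.coe_X, Polynomial.coe_C, Polynomial.coe_pow] at h3
  rw [← h3]
  refine Finset.prod_congr rfl fun a _ => ?_
  rw [map_neg, sub_neg_eq_add, add_comm]

theorem smallUnits_zmod {B : ℕ} (hB : B < p) : SmallUnits (ZMod p) B := by
  intro c hc hc'
  rw [isUnit_iff_ne_zero, Ne, ZMod.intCast_zmod_eq_zero_iff_dvd]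
  intro h
  exact hc (Int.eq_zero_of_abs_lt_dvd h (by zify at hB; omega))

theorem SmallUnits.map {C C' : Type*} [CommRing C] [CommRing C'] {B : ℕ} (h : SmallUnits C B)
    (f : C →+* C') : SmallUnits C' B := by
  intro c hc hc'
  simpa using (h c hc hc').map f

/-- If the words of nonzero degree divisible by `p` vanish, then the terms of low degree of the
cyclic determinant are the regularized ones. -/
theorem coeff_pencil_cyclic {C : Type*} [CommRing C] (φ : ZMod p →+* C) {n : ℕ} (l : Fin n → ℤ)
    {m k : ℕ} (hp : 2 * radius l + (2 * m + n + 1) * k + 1 < p) (T : ℕ × ℕ → C)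
    {Λ : Finset (ℕ × ℕ)} (hΛ : ∀ x ∈ Λ, x.2 ≤ m) (hΛ' : letters m k ⊆ Λ)
    (hT : ∀ w : List (ℕ × ℕ), w.length ≤ k → (∀ x ∈ w, x ∈ Λ) → (shift w : ZMod p) = 0 →
      shift w ≠ 0 → (w.map T).prod = 0) :
    (pencil (fun a : ZMod p => φ (∏ s, (a - (l s : ZMod p))))
      (shiftMatrix Λ T fun j a => φ (falling a j))).coeff k = regDet l m T k := by
  have hp' : 2 * radius l + 2 * m * k + n * k + k + 1 < p := by linarith
  let Φ : (ZMod p)⟦X⟧ →+* C⟦X⟧ := PowerSeries.map φ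
  let P : ZMod p → C⟦X⟧ := fun a => Φ (∏ s, (PowerSeries.C (a - (l s : ZMod p)) + PowerSeries.X))
  let V : ZMod p → C⟦X⟧ := fun a => Φ (∏ s, pole (a - (l s : ZMod p)))
  let K : Matrix (ZMod p) (ZMod p) C⟦X⟧ := shiftMatrix Λ (fun x => PowerSeries.C (T x))
    fun j a => Φ (falling (PowerSeries.C a + PowerSeries.X) j)
  let K' : Matrix (ZMod p) (ZMod p) C⟦X⟧ := shiftMatrix Λ (fun x => PowerSeries.C (T x))
    fun j a => Φ (letterValField l j a)
  have hV : ∀ a, P a * V a = PowerSeries.X ^ n := by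
    intro a
    simp only [P, V, ← map_mul, ← Finset.prod_mul_distrib, add_X_mul_pole]
    simp [Φ]
  have hK' : (Matrix.of fun b a => K b a * V a) = K' := by
    simp only [K, K', shiftMatrix_mul]
    congr 1
    funext j a
    simp only [V, letterValField, map_mul]
  have hu : ∀ i : ℕ, 1 ≤ i → i ≤ k → IsUnit (i : C⟦X⟧) := by
    intro i h1 h2
    have h3 := (((smallUnits_zmod (p := p) (B := k) (by omega)).natCast i h1 h2).map φ).map
      (PowerSeries.C (R := C))
    simpa using h3
  -- Agreement modulo `ε^(p-1)` is enough, since only the coefficient of `ε^(n * k)` will be used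
  -- and `n * k < p - 1`.
  have htr : ∀ i, 1 ≤ i → i ≤ k → (PowerSeries.X : C⟦X⟧) ^ (p - 1) ∣
      (K' ^ i).trace - regTrace l m T i := by
    intro i _ hi
    have hmi : m * i ≤ m * k := Nat.mul_le_mul_left m hi
    have hni : n * i ≤ n * k := Nat.mul_le_mul_left n hi
    have hli : letters m i ⊆ Λ := by
      intro x hx
      rw [mem_letters] at hx
      exact hΛ' (mem_letters.mpr ⟨by omega, hx.2⟩)
    rw [trace_shiftMatrix_pow, regTrace, wordSum_subset hli, ← Ideal.mem_span_singleton,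
      ← Ideal.Quotient.eq, map_wordSum, map_wordSum]
    · refine wordSum_congr fun w hw hw' => ?_
      have hwm : ∀ x ∈ w, x.2 ≤ m := fun x hx => hΛ x (hw' x hx)
      by_cases h0 : shift w = 0
      · rw [if_pos h0, if_pos (by rw [h0, Int.cast_zero]), Ideal.Quotient.eq,
          Ideal.mem_span_singleton, map_list_prod, List.map_map]
        have h1 : ∑ a : ZMod p, wordVal (fun j a => Φ (letterValField l j a)) w a =
            Φ (∑ a : ZMod p, wordVal (letterValField l) w a) := by
          rw [map_sum]
          exact Finset.sum_congr rfl fun a _ => (map_wordVal Φ w fun v _ j => rfl).symm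
        rw [h1, ← map_polarSum φ l (r := i) (smallUnits_zmod (by nlinarith)) (n * i) hwm h0 hw]
        change _ ∣ (w.map fun x => PowerSeries.C (T x)).prod * _ -
          (w.map fun x => PowerSeries.C (T x)).prod * _
        rw [← mul_sub]
        refine Dvd.dvd.mul_left ?_ _
        change _ ∣ Φ _ - Φ _
        rw [← map_sub, PowerSeries.X_pow_dvd_iff]
        intro d hd
        rw [PowerSeries.coeff_map, map_sub, ← hw, coeff_sum_wordVal l hwm h0 (by
          rw [hw]; nlinarith) hd, sub_self, map_zero]
      · rw [if_neg h0]
        split_ifs with h1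
        · have h2 := hT w (by omega) hw' h1 h0
          have h3 : (w.map fun x => PowerSeries.C (T x)).prod = (0 : C⟦X⟧) := by
            rw [← map_zero (PowerSeries.C (R := C)), ← h2, map_list_prod, List.map_map]
            rfl
          rw [h3, zero_mul]
        · rfl
    · intro w hw hw' ⟨x, hx, hx'⟩
      refine if_neg fun h0 => hx' ?_
      rw [← hw]
      exact mem_letters_of_shift_eq_zero (fun x hx => hΛ x (hw' x hx)) h0 hx
  have hF : (PowerSeries.X : C⟦X⟧) ^ (p - 1) ∣
      (fredholm K').coeff k - newton (regTrace l m T) k := by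
    rw [fredholm_coeff K' hu, ← Ideal.mem_span_singleton, ← Ideal.Quotient.eq,
      map_newton _ _ hu k le_rfl, map_newton _ _ hu k le_rfl]
    refine newton_congr (k := k) (fun i h1 h2 => ?_) k le_rfl
    rw [Ideal.Quotient.eq, Ideal.mem_span_singleton]
    exact htr i h1 h2
  have hprod : ∏ a, P a = (PowerSeries.X ^ p - PowerSeries.X) ^ n := by
    simp only [P]
    rw [← map_prod, Finset.prod_comm]
    have : ∀ s : Fin n, ∏ a : ZMod p, (PowerSeries.C (a - (l s : ZMod p)) + PowerSeries.X) =
        (PowerSeries.X ^ p - PowerSeries.X : (ZMod p)⟦X⟧) := fun s => by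
      rw [← prod_C_add_X, ← Equiv.prod_comp (Equiv.addRight (l s : ZMod p))]
      simp only [Equiv.coe_addRight, add_sub_cancel_right]
    simp only [this, Finset.prod_const, Finset.card_univ, Fintype.card_fin]
    simp [Φ]
  have hpow : (PowerSeries.X : C⟦X⟧) ^ (p - 1) ∣
      (PowerSeries.X ^ p - PowerSeries.X) ^ n - (-PowerSeries.X) ^ n := by
    refine Dvd.dvd.trans ?_ (sub_dvd_pow_sub_pow _ _ n)
    rw [sub_neg_eq_add, sub_add_cancel]
    exact pow_dvd_pow _ (Nat.sub_le p 1)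
  -- Scaling `K` by `ε^n` multiplies the coefficient of `s^k` by `ε^(n * k)`. Its constant term is
  -- therefore the coefficient of `ε^(n * k)` on the right.
  have hmain : PowerSeries.X ^ (n * k) * (pencil P K).coeff k =
      (PowerSeries.X ^ p - PowerSeries.X) ^ n * (fredholm K').coeff k := by
    have h1 := congrArg (fun f => f.coeff k) (pencil_eq_fredholm hV K)
    simp only [Polynomial.coeff_C_mul, coeff_pencil_mul, hK', hprod] at h1
    rw [← h1, ← pow_mul, mul_comm]
  have hconst : PowerSeries.constantCoeff ((pencil P K).coeff k) =
      (pencil (fun a : ZMod p => φ (∏ s, (a - (l s : ZMod p))))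
        (shiftMatrix Λ T fun j a => φ (falling a j))).coeff k := by
    rw [← Polynomial.coeff_map, map_pencil, map_shiftMatrix]
    have hΦ : ∀ f, PowerSeries.constantCoeff (Φ f) = φ (PowerSeries.constantCoeff f) := by
      intro f
      rw [← PowerSeries.coeff_zero_eq_constantCoeff_apply, PowerSeries.coeff_map,
        PowerSeries.coeff_zero_eq_constantCoeff_apply]
    simp only [P, hΦ, map_falling, map_prod, map_add]
    simp
  rw [← hconst, regDet, ← PowerSeries.coeff_zero_eq_constantCoeff_apply]
  have h1 := PowerSeries.coeff_X_pow_mul ((pencil P K).coeff k) (n * k) 0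
  rw [zero_add] at h1
  rw [← h1, hmain, ← sub_eq_zero, ← map_sub]
  refine PowerSeries.X_pow_dvd_iff.mp (?_ : (PowerSeries.X : C⟦X⟧) ^ (p - 1) ∣ _) (n * k) (by omega)
  have h2 := (hpow.mul_right ((fredholm K').coeff k)).add (hF.mul_left ((-PowerSeries.X) ^ n))
  convert h2 using 1
  ring

end Prime

/-- Conjugation by `diag D` without inverting it; this permits `D a = X^a`. -/
theorem pencil_conj {ι S : Type*} [Fintype ι] [DecidableEq ι] [CommRing S] {P : ι → S}
    {K K' : Matrix ι ι S} {D : ι → S} (hD : IsLeftRegular (∏ a, D a))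
    (h : ∀ b a, K b a * D a = D b * K' b a) : pencil P K = pencil P K' := by
  have h1 : (Polynomial.C (∏ a, D a) : Polynomial S) =
      (Matrix.diagonal fun a => Polynomial.C (D a)).det := by
    rw [Matrix.det_diagonal, map_prod]
  have h2 : pencil P K * Polynomial.C (∏ a, D a) = Polynomial.C (∏ a, D a) * pencil P K' := by
    rw [h1, pencil, pencil, ← Matrix.det_mul, ← Matrix.det_mul]
    congr 1
    ext1 b a
    rw [Matrix.mul_diagonal, Matrix.diagonal_mul]
    simp only [Matrix.of_apply, add_mul, mul_add, mul_assoc, ← map_mul, h]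
    rw [mul_left_comm, ← map_mul]
    by_cases hb : b = a
    · simp [hb, mul_comm]
    · simp [hb]
  ext i
  have h3 := congrArg (fun f => f.coeff i) h2
  simp only [mul_comm _ (Polynomial.C (∏ a, D a)), Polynomial.coeff_C_mul] at h3
  exact hD h3

/-! ### From the cyclic matrix to the quotient by `x^p` -/

section Prime

variable {p : ℕ} [Fact p.Prime]

/-- The coefficients of the operators `x^i ∂^j` that contribute to the quotient by `x^p`. -/
def allLetters (m p : ℕ) : Finset (ℕ × ℕ) := Finset.range (p + m) ×ˢ Finset.range (m + 1)

/-- The matrix of the operator `∑ t x^i ∂^j` on the quotient by `x^p`. -/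
def truncMatrix {A : Type*} [CommRing A] (φ : ZMod p →+* A) (m : ℕ) (t : ℕ × ℕ → A) :
    Matrix (ZMod p) (ZMod p) A :=
  Matrix.of fun b a => ∑ x ∈ allLetters m p,
    if b.val + x.2 = a.val + x.1 then t x * φ (falling a x.2) else 0

theorem falling_eq_zero {a : ZMod p} {j : ℕ} (h : a.val < j) : falling a j = 0 := by
  refine Finset.prod_eq_zero (Finset.mem_range.mpr h) ?_
  rw [ZMod.natCast_zmod_val, sub_self]

theorem val_add_eq {a b : ZMod p} {x : ℕ × ℕ} (hx : x.2 ≤ a.val) :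
    b = a + (((x.1 : ℤ) - x.2 : ℤ) : ZMod p) ↔ b.val = (a.val + x.1 - x.2) % p := by
  have h : a + (((x.1 : ℤ) - x.2 : ℤ) : ZMod p) = ((a.val + x.1 - x.2 : ℕ) : ZMod p) := by
    rw [Nat.cast_sub (by omega)]
    push_cast
    rw [ZMod.natCast_zmod_val]
    ring
  rw [h, ← ZMod.val_natCast]
  exact ⟨fun h => by rw [h], fun h => ZMod.val_injective p h⟩

/-- The terms of low degree of the determinant are the regularized ones. -/
theorem coeff_pencil_truncMatrix {A : Type*} [CommRing A] (φ : ZMod p →+* A) {n : ℕ}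
    (l : Fin n → ℤ) {m k : ℕ} (hp : 2 * radius l + (2 * m + n + 1) * k + 1 < p) (t : ℕ × ℕ → A) :
    (pencil (fun a : ZMod p => φ (∏ s, (a - (l s : ZMod p)))) (truncMatrix φ m t)).coeff k =
      regDet l m t k := by
  have hp' : 2 * radius l + 2 * (m * k) + n * k + k + 1 < p := by linarith
  let Q := Polynomial A ⧸ Ideal.span {(Polynomial.X : Polynomial A) ^ p}
  let π : Polynomial A →+* Q := Ideal.Quotient.mk _
  have hπ : ∀ i, p ≤ i → π (Polynomial.X ^ i) = 0 := fun i hi =>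
    Ideal.Quotient.eq_zero_iff_mem.mpr (Ideal.mem_span_singleton.mpr (pow_dvd_pow _ hi))
  let f : A →+* Q := π.comp Polynomial.C
  let z : Q := π Polynomial.X
  let P : ZMod p → A := fun a => φ (∏ s, (a - (l s : ZMod p)))
  let T : ℕ × ℕ → Polynomial A := fun x => Polynomial.X ^ (x.1 + (m - x.2)) * Polynomial.C (t x)
  let K : Matrix (ZMod p) (ZMod p) (Polynomial A) :=
    shiftMatrix (allLetters m p) T fun j a => Polynomial.C (φ (falling a j))
  let K' : Matrix (ZMod p) (ZMod p) (Polynomial A) := Matrix.of fun b a =>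
    ∑ x ∈ allLetters m p, if b = a + (((x.1 : ℤ) - x.2 : ℤ) : ZMod p) then
      Polynomial.C (t x * φ (falling a x.2)) *
        Polynomial.X ^ (m + p * ((a.val + x.1 - x.2) / p)) else 0
  have hletter : ∀ x ∈ allLetters m p, x.2 ≤ m := by
    intro x hx
    rw [allLetters, Finset.mem_product, Finset.mem_range, Finset.mem_range] at hx
    omega
  -- Conjugation by `diag X^a` turns the weight `X^(i + m - j)` into `X^m` times a factor `X^p` for
  -- each turn around the cycle. Modulo `X^p` only the entries that do not wrap remain.
  have hconj : pencil (fun a => Polynomial.C (P a)) K = pencil (fun a => Polynomial.C (P a)) K' := by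
    refine pencil_conj (D := fun a => Polynomial.X ^ a.val) ?_ fun b a => ?_
    · rw [Finset.prod_pow_eq_pow_sum]
      exact (Polynomial.monic_X_pow _).isRegular.left
    · simp only [K, K', shiftMatrix, Matrix.of_apply, Finset.sum_mul, Finset.mul_sum]
      refine Finset.sum_congr rfl fun x hx => ?_
      by_cases hb : b = a + (((x.1 : ℤ) - x.2 : ℤ) : ZMod p)
      · rw [if_pos hb, if_pos hb]
        -- Where the subtraction `a + i - j` could be truncated, the falling factorial vanishes.
        by_cases ha : a.val < x.2
        · simp [falling_eq_zero ha]
        · have h1 := (val_add_eq (not_lt.mp ha)).mp hb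
          have h2 := hletter x hx
          have h3 : x.1 + (m - x.2) + a.val = b.val + (m + p * ((a.val + x.1 - x.2) / p)) := by
            rw [h1]
            have := Nat.mod_add_div (a.val + x.1 - x.2) p
            omega
          have h4 : (Polynomial.X : Polynomial A) ^ (x.1 + (m - x.2)) * Polynomial.X ^ a.val =
              Polynomial.X ^ b.val *
                Polynomial.X ^ (m + p * ((a.val + x.1 - x.2) / p)) := by
            rw [← pow_add, ← pow_add, h3]
          simp only [T, map_mul]
          linear_combination (Polynomial.C (t x) * Polynomial.C (φ (falling a x.2))) * h4
      · rw [if_neg hb, if_neg hb, zero_mul, mul_zero]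
  have hK' : K'.map π = Matrix.of fun b a => z ^ m * ((truncMatrix φ m t).map f) b a := by
    ext b a
    simp only [K', truncMatrix, Matrix.map_apply, Matrix.of_apply, map_sum, Finset.mul_sum]
    refine Finset.sum_congr rfl fun x hx => ?_
    by_cases ha : a.val < x.2
    · simp [falling_eq_zero ha]
    · rw [if_congr (val_add_eq (not_lt.mp ha)) rfl rfl]
      have hmod := Nat.mod_add_div (a.val + x.1 - x.2) p
      have hb := ZMod.val_lt b
      rcases Nat.lt_or_ge (a.val + x.1 - x.2) p with h1 | h1
      · rw [Nat.mod_eq_of_lt h1, Nat.div_eq_of_lt h1]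
        have h2 : b.val = a.val + x.1 - x.2 ↔ b.val + x.2 = a.val + x.1 := by omega
        rw [if_congr h2 rfl rfl]
        split_ifs
        · simp only [mul_zero, add_zero, map_mul, map_pow]
          exact mul_comm _ _
        · simp
      · rw [if_neg (show ¬ b.val + x.2 = a.val + x.1 by omega), map_zero, mul_zero]
        split_ifs
        · rw [map_mul, hπ, mul_zero]
          have h3 : 1 ≤ (a.val + x.1 - x.2) / p := Nat.div_pos h1 (Fact.out : p.Prime).pos
          nlinarith
        · simp
  have hK : K.map π = shiftMatrix (allLetters m p)
      (fun x => z ^ (x.1 + (m - x.2)) * f (t x)) fun j a => (f.comp φ) (falling a j) := by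
    rw [map_shiftMatrix]
    congr 1
  have hcyc := coeff_pencil_cyclic (f.comp φ) l hp (fun x => z ^ (x.1 + (m - x.2)) * f (t x))
    hletter (Λ := allLetters m p) (by
      intro x hx
      rw [mem_letters] at hx
      rw [allLetters, Finset.mem_product, Finset.mem_range, Finset.mem_range]
      omega) (by
      intro w hw hw' h0 h1
      obtain ⟨e, he, he'⟩ := prod_map_rescale (fun x => f (t x)) z w
        fun x hx => hletter x (hw' x hx)
      rw [he']
      have h2 := neg_le_shift w fun x hx => hletter x (hw' x hx)
      have h3 : m * w.length ≤ m * k := Nat.mul_le_mul_left m hw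
      -- The degree is a nonzero multiple of `p` and exceeds `-p`, so it is at least `p`.
      have h4 : p ≤ e := by
        rw [ZMod.intCast_zmod_eq_zero_iff_dvd] at h0
        obtain ⟨c, hc⟩ := h0
        have h5 : (m * w.length : ℤ) < p := by exact_mod_cast (by omega : m * w.length < p)
        have hpos : (0 : ℤ) < p := by exact_mod_cast (Fact.out : p.Prime).pos
        have h6 : 0 < c := by
          by_contra hcon
          rcases lt_or_eq_of_le (not_lt.mp hcon) with h | h
          · nlinarith
          · exact h1 (by rw [hc, h, mul_zero])
        have h7 : (p : ℤ) ≤ shift w := by nlinarith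
        have h8 : (0 : ℤ) ≤ m * w.length := by positivity
        zify
        linarith
      have h5 : z ^ e = 0 := by
        rw [← map_pow]
        exact hπ e h4
      rw [h5, zero_mul])
  have hreg := regDet_rescale l m (fun x => f (t x)) z k
  have hunits : SmallUnits A (2 * radius l + (2 * m + 1) * k) :=
    (smallUnits_zmod (p := p) (by nlinarith)).map φ
  rw [← map_regDet f l m t hunits] at hreg
  rw [hreg, ← hK] at hcyc
  have hP : (fun a : ZMod p => (f.comp φ) (∏ s, (a - (l s : ZMod p)))) =
      fun a => π (Polynomial.C (P a)) := rfl
  rw [hP, ← map_pencil, hconj, map_pencil, hK', coeff_pencil_mul] at hcyc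
  have hP' : (fun a => π (Polynomial.C (P a))) = fun a => f (P a) := rfl
  rw [hP', ← map_pencil, Polynomial.coeff_map, ← pow_mul, mul_comm] at hcyc
  -- Both sides carry the factor `X^(m * k)`; as `m * k < p`, it can be cancelled modulo `X^p`.
  have hdiff : π (Polynomial.X ^ (m * k) *
      Polynomial.C ((pencil P (truncMatrix φ m t)).coeff k - regDet l m t k)) = 0 := by
    rw [map_mul, map_pow, map_sub Polynomial.C, map_sub π, mul_sub, sub_eq_zero]
    exact hcyc
  rw [Ideal.Quotient.eq_zero_iff_mem, Ideal.mem_span_singleton, Polynomial.X_pow_dvd_iff] at hdiff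
  have h1 := hdiff (m * k) (by omega)
  rw [Polynomial.coeff_X_pow_mul', if_pos le_rfl, Nat.sub_self, Polynomial.coeff_C_zero] at h1
  exact sub_eq_zero.mp h1

end Prime

/-! ### Powers of the ideal containing the terms of degree `k` -/

section Prime

variable {p : ℕ} [Fact p.Prime]

theorem truncMatrix_apply_eq_zero {A : Type*} [CommRing A] (φ : ZMod p →+* A) {m : ℕ}
    (t : ℕ × ℕ → A) {b a : ZMod p} (h : b.val + m < a.val) : truncMatrix φ m t b a = 0 := by
  refine Finset.sum_eq_zero fun x hx => if_neg ?_
  rw [allLetters, Finset.mem_product, Finset.mem_range, Finset.mem_range] at hx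
  omega

theorem truncMatrix_apply_mem {A : Type*} [CommRing A] (φ : ZMod p →+* A) {m : ℕ}
    {t : ℕ × ℕ → A} {J : Ideal A} (ht : ∀ x : ℕ × ℕ, x.1 ≤ x.2 → t x ∈ J) {b a : ZMod p}
    (h : b.val ≤ a.val) : truncMatrix φ m t b a ∈ J := by
  refine J.sum_mem fun x _ => ?_
  split_ifs with h1
  · exact J.mul_mem_right _ (ht x (by omega))
  · exact J.zero_mem

/-- The term of degree `k` of the determinant lies in a power of the ideal of the coefficients
of the operators `x^i ∂^j` with `i ≤ j`. -/
theorem coeff_pencil_mem {A : Type*} [CommRing A] (φ : ZMod p →+* A) {m : ℕ}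
    {t : ℕ × ℕ → A} {J : Ideal A} (ht : ∀ x : ℕ × ℕ, x.1 ≤ x.2 → t x ∈ J) (P : ZMod p → A)
    {k d : ℕ} (hd : (m + 1) * d ≤ k + m) :
    (pencil P (truncMatrix φ m t)).coeff k ∈ J ^ d := by
  classical
  rw [pencil, Matrix.det_apply', Polynomial.finsetSum_coeff]
  refine Ideal.sum_mem _ fun σ _ => ?_
  rw [Polynomial.coeff_intCast_mul]
  refine Ideal.mul_mem_left _ _ ?_
  -- `S` is the set of columns in which the entry of `K` is chosen; `σ` must fix the others, and the
  -- power of `s` forces `S.card = k`.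
  simp only [Matrix.of_apply, add_comm (ite _ _ _)]
  rw [Finset.prod_add, Polynomial.finsetSum_coeff]
  refine Ideal.sum_mem _ fun S _ => ?_
  rw [Finset.prod_mul_distrib, Finset.prod_const, ← map_prod, mul_assoc,
    Polynomial.coeff_X_pow_mul']
  by_cases hS : ∃ a ∉ S, σ a ≠ a
  · obtain ⟨a, ha, hσ⟩ := hS
    rw [Finset.prod_eq_zero (i := a) (s := Finset.univ \ S) (by simp [ha]) (if_neg hσ)]
    simp
  · push Not at hS
    split_ifs with hk
    swap
    · exact Ideal.zero_mem _
    have hconst : ∏ a ∈ Finset.univ \ S,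
        (if σ a = a then Polynomial.C (P a) else 0 : Polynomial A) =
          Polynomial.C (∏ a ∈ Finset.univ \ S, P a) := by
      rw [map_prod]
      exact Finset.prod_congr rfl fun a ha => if_pos (hS a (by simpa using ha))
    rw [hconst, ← map_mul, Polynomial.coeff_C]
    split_ifs with hk'
    swap
    · exact Ideal.zero_mem _
    refine Ideal.mul_mem_right _ _ ?_
    by_cases hzero : ∃ a ∈ S, (σ a).val + m < a.val
    · obtain ⟨a, ha, h⟩ := hzero
      have h0 := Finset.prod_eq_zero (f := fun a => truncMatrix φ m t (σ a) a) ha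
        (truncMatrix_apply_eq_zero φ t h)
      rw [show ∏ a ∈ S, truncMatrix φ m t (σ a) a = 0 from h0]
      exact Ideal.zero_mem _
    push Not at hzero
    let D := S.filter fun a => (σ a).val ≤ a.val
    have hsum : ∑ a ∈ S, (((σ a).val : ℤ) - a.val) = 0 := by
      have h1 : ∑ a : ZMod p, (((σ a).val : ℤ) - a.val) = 0 := by
        rw [Finset.sum_sub_distrib, Equiv.sum_comp σ fun a => (a.val : ℤ), sub_self]
      rw [← h1]
      refine Finset.sum_subset (Finset.subset_univ S) fun a _ ha => ?_
      rw [hS a ha, sub_self]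
    -- The total displacement is zero; columns in `D` fall by at most `m` and the others rise by at
    -- least one, so there are at most `m * D.card` others.
    have hcard : S.card ≤ (m + 1) * D.card := by
      have h1 := Finset.sum_filter_add_sum_filter_not S (fun a => (σ a).val ≤ a.val)
        fun a => (((σ a).val : ℤ) - a.val)
      have h2 := Finset.card_filter_add_card_filter_not (s := S) fun a => (σ a).val ≤ a.val
      have h3 : D.card • (-(m : ℤ)) ≤ ∑ a ∈ D, (((σ a).val : ℤ) - a.val) := by
        refine Finset.card_nsmul_le_sum _ _ _ fun a ha => ?_
        have := hzero a (Finset.mem_filter.mp ha).1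
        omega
      have h4 : (S.filter fun a => ¬ (σ a).val ≤ a.val).card • (1 : ℤ) ≤
          ∑ a ∈ S.filter (fun a => ¬ (σ a).val ≤ a.val), (((σ a).val : ℤ) - a.val) := by
        refine Finset.card_nsmul_le_sum _ _ _ fun a ha => ?_
        have := (Finset.mem_filter.mp ha).2
        omega
      rw [hsum] at h1
      simp only [nsmul_eq_mul, mul_one] at h3 h4
      change D.card + _ = _ at h2
      have h5 : (D.card : ℤ) + (S.filter fun a => ¬ (σ a).val ≤ a.val).card = S.card := by
        exact_mod_cast h2
      change ∑ a ∈ D, _ + _ = _ at h1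
      have h6 : (S.card : ℤ) ≤ (m + 1) * D.card := by linarith
      exact_mod_cast h6
    have hdD : d ≤ D.card := by
      have h1 : (m + 1) * d < (m + 1) * (D.card + 1) := by
        have : S.card = k := by omega
        rw [mul_add]
        omega
      have := Nat.lt_of_mul_lt_mul_left h1
      omega
    have hD : ∏ a ∈ D, truncMatrix φ m t (σ a) a ∈ J ^ D.card := by
      rw [← Finset.prod_const]
      exact Ideal.prod_mem_prod fun a ha =>
        truncMatrix_apply_mem φ ht (Finset.mem_filter.mp ha).2
    rw [← Finset.prod_filter_mul_prod_filter_not S fun a => (σ a).val ≤ a.val]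
    exact Ideal.mul_mem_right _ _ (Ideal.pow_le_pow_right hdD hD)

end Prime

/-- The same count for words: `d` is the number of letters with `i ≤ j`, each lowering the degree by
at most `m`, while all others raise it by at least one. -/
theorem prod_mem_pow_of_shift {A : Type*} [CommRing A] {m : ℕ} {t : ℕ × ℕ → A} {J : Ideal A}
    (ht : ∀ x : ℕ × ℕ, x.1 ≤ x.2 → t x ∈ J) (w : List (ℕ × ℕ)) (hw : ∀ x ∈ w, x.2 ≤ m) :
    ∃ d : ℕ, (w.length : ℤ) ≤ (m + 1) * d + shift w ∧ (w.map t).prod ∈ J ^ d := by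
  induction w with
  | nil => exact ⟨0, by simp, by simp⟩
  | cons x w ih =>
    obtain ⟨d, hd, hd'⟩ := ih fun y hy => hw y (by simp [hy])
    rw [List.map_cons, List.prod_cons, List.length_cons, shift_cons]
    rcases Nat.lt_or_ge x.2 x.1 with h | h
    · refine ⟨d, ?_, Ideal.mul_mem_left _ _ hd'⟩
      push_cast
      have : (x.2 : ℤ) + 1 ≤ x.1 := by exact_mod_cast h
      linarith
    · refine ⟨d + 1, ?_, ?_⟩
      · have h1 : (x.2 : ℤ) ≤ m := by exact_mod_cast hw x (by simp)
        have h2 : (0 : ℤ) ≤ x.1 := by positivity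
        push_cast
        linarith
      · rw [pow_succ']
        exact Ideal.mul_mem_mul (ht x h) hd'

theorem coeff_mul_mem {A : Type*} [CommRing A] {J J' : Ideal A} {f g : A⟦X⟧}
    (hf : ∀ r, PowerSeries.coeff r f ∈ J) (hg : ∀ r, PowerSeries.coeff r g ∈ J') (r : ℕ) :
    PowerSeries.coeff r (f * g) ∈ J * J' := by
  rw [PowerSeries.coeff_mul]
  exact Ideal.sum_mem _ fun x _ => Ideal.mul_mem_mul (hf _) (hg _)

theorem coeff_mul_mem_right {A : Type*} [CommRing A] {J : Ideal A} {f : A⟦X⟧} (g : A⟦X⟧)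
    (hf : ∀ r, PowerSeries.coeff r f ∈ J) (r : ℕ) : PowerSeries.coeff r (g * f) ∈ J := by
  rw [PowerSeries.coeff_mul]
  exact Ideal.sum_mem _ fun x _ => Ideal.mul_mem_left _ _ (hf _)

theorem coeff_regTrace_mem {A : Type*} [CommRing A] {n : ℕ} (l : Fin n → ℤ) {m : ℕ}
    {t : ℕ × ℕ → A} {J : Ideal A} (ht : ∀ x : ℕ × ℕ, x.1 ≤ x.2 → t x ∈ J) {r d : ℕ}
    (hd : (m + 1) * d ≤ r + m) (i : ℕ) : PowerSeries.coeff i (regTrace l m t r) ∈ J ^ d := by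
  rw [regTrace, map_wordSum (PowerSeries.coeff (R := A) i)]
  refine wordSum_mem (J ^ d).toAddSubmonoid fun w hw hw' => ?_
  change _ ∈ J ^ d
  split_ifs with h0
  · rw [PowerSeries.coeff_C_mul]
    refine Ideal.mul_mem_right _ _ ?_
    obtain ⟨e, he, he'⟩ := prod_mem_pow_of_shift ht w fun x hx => (mem_letters.mp (hw' x hx)).2
    rw [h0, hw, add_zero] at he
    refine Ideal.pow_le_pow_right ?_ he'
    have h1 : r ≤ (m + 1) * e := by exact_mod_cast he
    have h2 : (m + 1) * d < (m + 1) * (e + 1) := by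
      rw [mul_add]
      omega
    have := Nat.lt_of_mul_lt_mul_left h2
    omega
  · rw [map_zero]
    exact Ideal.zero_mem _

/-- The condition on `d` means `d ≤ ⌈r / (m + 1)⌉`, and this ceiling is subadditive, so Newton's
recursion respects the filtration. -/
theorem coeff_newton_mem {A : Type*} [CommRing A] {J : Ideal A} {m : ℕ} {τ : ℕ → A⟦X⟧}
    (hτ : ∀ r d i, (m + 1) * d ≤ r + m → PowerSeries.coeff i (τ r) ∈ J ^ d) (k : ℕ) :
    ∀ d i, (m + 1) * d ≤ k + m → PowerSeries.coeff i (newton τ k) ∈ J ^ d := by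
  induction k using Nat.strong_induction_on with
  | _ k ih =>
    intro d i hd
    cases k with
    | zero =>
      have : d = 0 := by
        by_contra h
        have : (m + 1) * 1 ≤ (m + 1) * d := Nat.mul_le_mul_left _ (by omega)
        omega
      simp [this]
    | succ k =>
      rw [newton_succ]
      refine coeff_mul_mem_right _ (fun r => ?_) i
      rw [map_sum]
      refine Ideal.sum_mem _ fun j hj => ?_
      have hj' := Finset.mem_range.mp hj
      have h1 := Nat.div_add_mod (k - j + m) (m + 1)
      have h1' := Nat.mod_lt (k - j + m) (show 0 < m + 1 by omega)
      have h2 := Nat.div_add_mod (j + 1 + m) (m + 1)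
      have h2' := Nat.mod_lt (j + 1 + m) (show 0 < m + 1 by omega)
      set d₁ := (k - j + m) / (m + 1)
      set d₂ := (j + 1 + m) / (m + 1)
      have hdd : d ≤ d₁ + d₂ := by
        have h3 : (m + 1) * d < (m + 1) * (d₁ + d₂ + 1) := by
          rw [mul_add, mul_add]
          omega
        have := Nat.lt_of_mul_lt_mul_left h3
        omega
      refine Ideal.pow_le_pow_right hdd ?_
      rw [pow_add]
      refine coeff_mul_mem (coeff_mul_mem_right _ fun s => ?_) (fun s => ?_) r
      · exact ih (k - j) (by omega) d₁ s (by omega)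
      · exact hτ (j + 1) d₂ s (by omega)

theorem regDet_mem {A : Type*} [CommRing A] {n : ℕ} (l : Fin n → ℤ) {m : ℕ}
    {t : ℕ × ℕ → A} {J : Ideal A} (ht : ∀ x : ℕ × ℕ, x.1 ≤ x.2 → t x ∈ J) {k d : ℕ}
    (hd : (m + 1) * d ≤ k + m) : regDet l m t k ∈ J ^ d :=
  coeff_mul_mem_right _ (fun i => coeff_newton_mem
    (fun _ _ i h => coeff_regTrace_mem l ht h i) k d i hd) _

/-- This matches the unperturbed determinant `∏ P(a)` over `ZMod p`, which vanishes for `n > 0`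
because `P` has a root. No integer has to be invertible, so the term of degree zero is correct even
for small primes. -/
theorem regDet_zero {A : Type*} [CommRing A] {n : ℕ} (l : Fin n → ℤ) (m : ℕ) (t : ℕ × ℕ → A) :
    regDet l m t 0 = if n = 0 then 1 else 0 := by
  rw [regDet, newton_zero, mul_one, mul_zero]
  split_ifs with h
  · simp [h]
  · simp [h]

/-! ### The matrix of the differential operator -/

theorem pencil_eval_one {ι S : Type*} [Fintype ι] [DecidableEq ι] [CommRing S] (P : ι → S)
    (K : Matrix ι ι S) :
    (pencil P K).eval 1 = (Matrix.of fun b a => (if b = a then P a else 0) + K b a).det := by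
  rw [pencil, ← Polynomial.coe_evalRingHom, RingHom.map_det]
  refine congrArg Matrix.det ?_
  ext1 b a
  by_cases h : b = a <;> simp [h]

theorem prod_euler_sub_X_pow {A : Type*} [CommRing A] (L : List A) (a : ℕ) :
    (L.map fun c => euler A - algebraMap A (Module.End A A⟦X⟧) c).prod
      ((PowerSeries.X : A⟦X⟧) ^ a) = (L.map fun c => (a : A) - c).prod • PowerSeries.X ^ a := by
  have he : euler A ((PowerSeries.X : A⟦X⟧) ^ a) = (a : A) • PowerSeries.X ^ a := by
    rw [euler, LinearMap.comp_apply]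
    change PowerSeries.X * PowerSeries.derivative A (PowerSeries.X ^ a) = _
    rw [Derivation.leibniz_pow, PowerSeries.derivative_X]
    cases a with
    | zero => simp
    | succ a =>
      rw [Nat.add_sub_cancel, PowerSeries.smul_eq_C_mul, map_natCast]
      simp only [nsmul_eq_mul, smul_eq_mul, mul_one]
      ring
  induction L with
  | nil => simp
  | cons c L ih =>
    rw [List.map_cons, List.prod_cons, Module.End.mul_apply, ih, map_smul, LinearMap.sub_apply, he,
      Module.algebraMap_end_apply, ← sub_smul, smul_smul, List.map_cons, List.prod_cons, mul_comm]

theorem derivative_pow_X_pow {A : Type*} [CommRing A] (a j : ℕ) :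
    ((PowerSeries.derivative A).toLinearMap ^ j) ((PowerSeries.X : A⟦X⟧) ^ a) =
      falling (a : A) j • PowerSeries.X ^ (a - j) := by
  induction j with
  | zero => simp [falling]
  | succ j ih =>
    rw [pow_succ', Module.End.mul_apply, ih, map_smul]
    change falling (a : A) j • PowerSeries.derivative A (PowerSeries.X ^ (a - j)) = _
    rw [Derivation.leibniz_pow, PowerSeries.derivative_X, falling, falling,
      Finset.prod_range_succ, mul_smul, Nat.sub_sub]
    rcases Nat.lt_or_ge a j with h | h
    · have h0 : ∏ u ∈ Finset.range j, ((a : A) - (u : A)) = 0 :=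
        Finset.prod_eq_zero (Finset.mem_range.mpr h) (sub_self _)
      rw [h0, zero_smul, zero_smul]
    · rw [← Nat.cast_sub h, smul_eq_mul, mul_one, Nat.cast_smul_eq_nsmul]

theorem coeff_diffOp_X_pow {A : Type*} [CommRing A] {n : ℕ} (l : Fin n → ℤ) (m : ℕ)
    (t : ℕ → ℕ → A) (a b : ℕ) :
    PowerSeries.coeff b (diffOp l m t (PowerSeries.X ^ a)) =
      (if b = a then ∏ s, ((a : A) - (l s : A)) else 0) +
        ∑ j ∈ Finset.range (m + 1),
          if a ≤ b + j then t (b + j - a) j * falling (a : A) j else 0 := by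
  rw [diffOp, LinearMap.add_apply, LinearMap.sum_apply, map_add, map_sum]
  congr 1
  · have h := prod_euler_sub_X_pow (List.ofFn fun s => (l s : A)) a
    rw [List.map_ofFn, List.map_ofFn, List.prod_ofFn] at h
    refine (congrArg (PowerSeries.coeff b) h).trans ?_
    rw [PowerSeries.coeff_smul, PowerSeries.coeff_X_pow]
    simp
  · refine Finset.sum_congr rfl fun j _ => ?_
    rw [LinearMap.comp_apply, derivative_pow_X_pow, LinearMap.mulLeft_apply, mul_smul_comm,
      PowerSeries.coeff_smul, PowerSeries.coeff_mul_X_pow']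
    rcases Nat.lt_or_ge a j with h | h
    · have h0 : falling (a : A) j = 0 :=
        Finset.prod_eq_zero (Finset.mem_range.mpr h) (sub_self _)
      simp [h0]
    · have h1 : a - j ≤ b ↔ a ≤ b + j := by omega
      rw [if_congr h1 rfl rfl, smul_eq_mul, mul_ite, mul_zero]
      split_ifs with h2
      · rw [PowerSeries.coeff_mk, show b - (a - j) = b + j - a by omega, mul_comm]
      · rfl

section Prime

variable {p : ℕ} [Fact p.Prime]

/-- The quotient of `A⟦x⟧` by the span of `x^p, x^(p+1), …` is free of rank `p`. -/
def quotTailEquiv (A : Type*) [CommRing A] (p : ℕ) [Fact p.Prime] :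
    (A⟦X⟧ ⧸ tail A p) ≃ₗ[A] (ZMod p → A) :=
  let f : A⟦X⟧ →ₗ[A] (ZMod p → A) := LinearMap.pi fun a => PowerSeries.coeff a.val
  have hker : tail A p = LinearMap.ker f := by
    ext g
    rw [LinearMap.mem_ker, funext_iff]
    refine ⟨fun h a => h _ (ZMod.val_lt a), fun h i hi => ?_⟩
    have := h (i : ZMod p)
    rwa [LinearMap.pi_apply, ZMod.val_natCast_of_lt hi] at this
  have hsurj : Function.Surjective f := by
    intro v
    refine ⟨PowerSeries.mk fun i => v (i : ZMod p), ?_⟩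
    funext a
    rw [LinearMap.pi_apply, PowerSeries.coeff_mk, ZMod.natCast_zmod_val]
  (Submodule.quotEquivOfEq _ _ hker).trans (f.quotKerEquivOfSurjective hsurj)

theorem quotTailEquiv_mk {A : Type*} [CommRing A] (f : A⟦X⟧) (a : ZMod p) :
    quotTailEquiv A p (Submodule.Quotient.mk f) a = PowerSeries.coeff a.val f := rfl

theorem det_mapQ_diffOp {A : Type*} [CommRing A] (φ : ZMod p →+* A) {n : ℕ} (l : Fin n → ℤ)
    (m : ℕ) (t : ℕ → ℕ → A) (h : tail A p ≤ (tail A p).comap (diffOp l m t)) :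
    LinearMap.det ((tail A p).mapQ (tail A p) (diffOp l m t) h) =
      (pencil (fun a : ZMod p => φ (∏ s, (a - (l s : ZMod p))))
        (truncMatrix φ m fun x => t x.1 x.2)).eval 1 := by
  rw [pencil_eval_one, ← LinearMap.det_conj _ (quotTailEquiv A p), ← LinearMap.det_toLin']
  congr 1
  refine (Pi.basisFun A (ZMod p)).ext fun a => ?_
  rw [Pi.basisFun_apply]
  have hsymm : (quotTailEquiv A p).symm (Pi.single a 1) =
      Submodule.Quotient.mk (PowerSeries.X ^ a.val) := by
    rw [LinearEquiv.symm_apply_eq]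
    funext b
    rw [quotTailEquiv_mk, PowerSeries.coeff_X_pow, Pi.single_apply]
    exact if_congr (ZMod.val_injective p).eq_iff.symm rfl rfl
  funext b
  rw [Matrix.toLin'_apply, Matrix.mulVec_single_one, LinearMap.comp_apply, LinearMap.comp_apply,
    LinearEquiv.coe_coe, LinearEquiv.coe_coe, hsymm, Submodule.mapQ_apply]
  have hφ : φ a = (a.val : A) := by
    conv_lhs => rw [← ZMod.natCast_zmod_val a, map_natCast]
  refine (quotTailEquiv_mk _ b).trans ?_
  rw [coeff_diffOp_X_pow, Matrix.col_apply, Matrix.of_apply]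
  congr 1
  · rw [if_congr (ZMod.val_injective p).eq_iff rfl rfl, map_prod]
    simp [hφ]
  · rw [truncMatrix, Matrix.of_apply, allLetters, Finset.sum_product_right]
    refine Finset.sum_congr rfl fun j hj => ?_
    have hf : φ (falling a j) = falling (a.val : A) j := by rw [map_falling, hφ]
    simp only [hf]
    have hb := ZMod.val_lt b
    have hj' := Finset.mem_range.mp hj
    split_ifs with h1
    · rw [Finset.sum_eq_single (b.val + j - a.val), if_pos (by omega)]
      · intro i _ hi
        exact if_neg (by omega)
      · intro hi
        rw [Finset.mem_range] at hi
        by_cases hja : a.val < j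
        · have h0 : falling (a.val : A) j = 0 :=
            Finset.prod_eq_zero (Finset.mem_range.mpr hja) (sub_self _)
          rw [h0, mul_zero, ite_self]
        · omega
    · refine (Finset.sum_eq_zero fun i _ => if_neg ?_).symm
      omega

end Prime

/-! ### The limit and its comparison with the determinant through `ℤ_(p)` -/

/-- The canonical homomorphism from `ZMod p` to a ring in which `p = 0`. -/
theorem exists_zmod_ringHom {A : Type*} [CommRing A] {p : ℕ} (hp : (p : A) = 0) :
    Nonempty (ZMod p →+* A) := by
  refine ⟨(Ideal.Quotient.lift (Ideal.span {(p : ℤ)}) (Int.castRingHom A) ?_).comp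
    (Int.quotientSpanNatEquivZMod p).symm.toRingHom⟩
  intro a ha
  obtain ⟨b, rfl⟩ := Ideal.mem_span_singleton.mp ha
  simp [hp]

theorem X_mem_IQ {x : ℕ × ℕ} (h : x.1 ≤ x.2) : (MvPolynomial.X x : RQ) ∈ IQ := by
  have : toRQ (MvPolynomial.X x) = MvPolynomial.X x := MvPolynomial.map_X _ _
  rw [← this]
  exact Ideal.mem_map_of_mem _ (Ideal.subset_span ⟨x.1, x.2, h, rfl⟩)

/-- The partial sums of the regularized determinant. -/
def regDetSum {C : Type*} [CommRing C] {n : ℕ} (l : Fin n → ℤ) (m : ℕ) (t : ℕ × ℕ → C) (K : ℕ) :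
    C :=
  ∑ k ∈ Finset.range ((m + 1) * K - m), regDet l m t k

/-- The regularized determinant. -/
def regDetLimit {n : ℕ} (l : Fin n → ℤ) (m : ℕ) : CompletedRat :=
  AdicCompletion.mk IQ RQ (AdicCompletion.AdicCauchySequence.mk IQ RQ
    (regDetSum l m MvPolynomial.X) (by
    intro K
    have hle : (m + 1) * K - m ≤ (m + 1) * (K + 1) - m := by
      refine Nat.sub_le_sub_right (Nat.mul_le_mul_left _ (Nat.le_succ K)) m
    refine SModEq.symm (SModEq.sub_mem.mpr ?_)
    rw [regDetSum, regDetSum, ← Finset.sum_sdiff (Finset.range_mono hle), add_sub_cancel_right,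
      smul_eq_mul, Ideal.mul_top]
    -- The added terms have `k ≥ (m + 1) * K - m`, that is `⌈k / (m + 1)⌉ ≥ K`.
    refine Ideal.sum_mem _ fun k hk => regDet_mem l (fun x hx => X_mem_IQ hx) ?_
    rw [Finset.mem_sdiff, Finset.mem_range, Finset.mem_range] at hk
    omega))

theorem evalₐ_regDetLimit {n : ℕ} (l : Fin n → ℤ) (m K : ℕ) :
    AdicCompletion.evalₐ IQ K (regDetLimit l m) =
      Ideal.Quotient.mk (IQ ^ K) (regDetSum l m MvPolynomial.X K) := by
  rw [regDetLimit, AdicCompletion.evalₐ_mk]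
  rfl

theorem map_regDetSum {C C' : Type*} [CommRing C] [CommRing C'] (f : C →+* C') {n : ℕ}
    (l : Fin n → ℤ) (m : ℕ) (t : ℕ × ℕ → C) {K : ℕ}
    (hC : ∀ k, 1 ≤ k → k < (m + 1) * K - m → SmallUnits C (2 * radius l + (2 * m + 1) * k)) :
    f (regDetSum l m t K) = regDetSum l m (fun x => f (t x)) K := by
  rw [regDetSum, regDetSum, map_sum]
  refine Finset.sum_congr rfl fun k hk => ?_
  rcases Nat.eq_zero_or_pos k with rfl | hk0
  · rw [regDet_zero, regDet_zero]
    split_ifs <;> simp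
  · exact map_regDet f l m t (hC k hk0 (Finset.mem_range.mp hk))

theorem pDet_sub_regDetSum_mem {n : ℕ} (l : Fin n → ℤ) (m : ℕ) {p : ℕ} (hp : p.Prime) {K : ℕ}
    (hK : ∀ k, 1 ≤ k → k < (m + 1) * K - m → 2 * radius l + (2 * m + n + 1) * k + 1 < p) :
    pDet l m p - regDetSum l m
        (fun x => Ideal.Quotient.mk (Ideal.span {(p : R)}) (MvPolynomial.X x)) K ∈
      (I ^ K).map (Ideal.Quotient.mk (Ideal.span {(p : R)})) := by
  have : Fact p.Prime := ⟨hp⟩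
  obtain ⟨φ⟩ := exists_zmod_ringHom (natCast_redMod R p)
  let t : ℕ × ℕ → RedMod R p := fun x => Ideal.Quotient.mk (Ideal.span {(p : R)}) (MvPolynomial.X x)
  let D := pencil (fun a : ZMod p => φ (∏ s, (a - (l s : ZMod p)))) (truncMatrix φ m t)
  have hdet : pDet l m p = D.eval 1 := det_mapQ_diffOp φ l m _ _
  have ht : ∀ x : ℕ × ℕ, x.1 ≤ x.2 →
      t x ∈ I.map (Ideal.Quotient.mk (Ideal.span {(p : R)})) := fun x hx =>
    Ideal.mem_map_of_mem _ (Ideal.subset_span ⟨x.1, x.2, hx, rfl⟩)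
  have hsum : D.eval 1 = ∑ k ∈ Finset.range (max (D.natDegree + 1) ((m + 1) * K - m)),
      D.coeff k := by
    rw [Polynomial.eval_eq_sum_range' (lt_of_lt_of_le (Nat.lt_succ_self _)
      (le_max_left _ ((m + 1) * K - m)))]
    simp
  have hreg : regDetSum l m t K = ∑ k ∈ Finset.range ((m + 1) * K - m), D.coeff k := by
    refine Finset.sum_congr rfl fun k hk => ?_
    -- The bound on `p` is only available for `k ≥ 1`; the term `k = 0` is computed directly.
    rcases Nat.eq_zero_or_pos k with rfl | hk0
    · rw [regDet_zero, Polynomial.coeff_zero_eq_eval_zero]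
      simp only [D]
      have h0 : (pencil (fun a : ZMod p => φ (∏ s, (a - (l s : ZMod p))))
          (truncMatrix φ m t)).eval 0 = ∏ a : ZMod p, φ (∏ s, (a - (l s : ZMod p))) := by
        rw [← Matrix.det_diagonal, pencil, ← Polynomial.coe_evalRingHom, RingHom.map_det]
        refine congrArg Matrix.det ?_
        ext1 b a
        by_cases h : b = a <;> simp [h, Polynomial.eval_prod]
      rw [h0]
      split_ifs with hn
      · subst hn
        simp
      · rw [Finset.prod_eq_zero (Finset.mem_univ (l ⟨0, Nat.pos_of_ne_zero hn⟩ : ZMod p))]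
        rw [Finset.prod_eq_zero (Finset.mem_univ ⟨0, Nat.pos_of_ne_zero hn⟩) (sub_self _), map_zero]
    · exact (coeff_pencil_truncMatrix φ l (hK k hk0 (Finset.mem_range.mp hk)) t).symm
  change _ - regDetSum l m t K ∈ _
  rw [hdet, hsum, hreg, ← Finset.sum_sdiff (Finset.range_mono (le_max_right _ _)),
    add_sub_cancel_right, Ideal.map_pow]
  refine Ideal.sum_mem _ fun k hk => coeff_pencil_mem φ ht _ ?_
  rw [Finset.mem_sdiff, Finset.mem_range, Finset.mem_range] at hk
  omega

/-- `Z` is the localization `ℤ_(p)`. The integers inverted in the partial sum are nonzero and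
smaller than `p`, hence units of `Z`, so one element of `Z[t]` maps both to the partial sum over `ℚ`
and to the one modulo `p`. -/
theorem congrMod_regDetLimit (Z : Type*) [CommRing Z] [Algebra ℤ Z] {p : ℕ} (hp : p.Prime)
    [h𝔭 : (Ideal.span {(p : ℤ)}).IsPrime] [IsLocalization.AtPrime Z (Ideal.span {(p : ℤ)})]
    {n : ℕ} (l : Fin n → ℤ) (m : ℕ) {K : ℕ}
    (hK : ∀ k, 1 ≤ k → k < (m + 1) * K - m → 2 * radius l + (2 * m + n + 1) * k + 1 < p) :
    CongrMod p K (pDet l m p) (regDetLimit l m) := by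
  let 𝔭 : Ideal ℤ := Ideal.span {(p : ℤ)}
  have hpp : Prime (p : ℤ) := Nat.prime_iff_prime_int.mp hp
  have hcop : ∀ s : ℤ, s ∉ 𝔭 → IsCoprime s (p : ℤ) := by
    intro s hs
    rw [isCoprime_comm, hpp.irreducible.coprime_iff_not_dvd]
    exact fun h => hs (Ideal.mem_span_singleton.mpr h)
  have hZ : ∀ B < p, SmallUnits Z B := by
    intro B hB c hc hc'
    rw [← eq_intCast (algebraMap ℤ Z)]
    refine IsLocalization.map_units Z (⟨c, fun h => hc ?_⟩ : 𝔭.primeCompl)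
    exact Int.eq_zero_of_abs_lt_dvd (Ideal.mem_span_singleton.mp h) (by zify at hB; omega)
  let toQ : Z →+* ℚ := IsLocalization.lift (M := 𝔭.primeCompl) (g := Int.castRingHom ℚ) (by
    rintro ⟨s, hs⟩
    refine isUnit_iff_ne_zero.mpr ?_
    simp only [eq_intCast, ne_eq, Int.cast_eq_zero]
    rintro rfl
    exact hs 𝔭.zero_mem)
  let toRed : Z →+* RedMod R p := IsLocalization.lift (M := 𝔭.primeCompl)
    (g := Int.castRingHom (RedMod R p)) (by
      rintro ⟨s, hs⟩
      obtain ⟨u, v, huv⟩ := hcop s hs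
      refine IsUnit.of_mul_eq_one (u : RedMod R p) ?_
      have h1 := congrArg (Int.cast : ℤ → RedMod R p) huv
      push_cast at h1
      rw [natCast_redMod, mul_zero, add_zero, mul_comm] at h1
      simpa using h1)
  let ψ : MvPolynomial (ℕ × ℕ) Z →+* RQ := MvPolynomial.map toQ
  let χ : MvPolynomial (ℕ × ℕ) Z →+* RedMod R p := MvPolynomial.eval₂Hom toRed fun x =>
    Ideal.Quotient.mk (Ideal.span {(p : R)}) (MvPolynomial.X x)
  have hA : ∀ k, 1 ≤ k → k < (m + 1) * K - m →
      SmallUnits (MvPolynomial (ℕ × ℕ) Z) (2 * radius l + (2 * m + 1) * k) := fun k h1 h2 =>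
    (hZ _ (by have := hK k h1 h2; nlinarith)).map MvPolynomial.C
  have hψ : ψ (regDetSum l m MvPolynomial.X K) = regDetSum l m MvPolynomial.X K := by
    rw [map_regDetSum ψ l m _ hA]
    congr 1
    funext x
    exact MvPolynomial.map_X _ _
  have hχ : χ (regDetSum l m MvPolynomial.X K) = regDetSum l m
      (fun x => Ideal.Quotient.mk (Ideal.span {(p : R)}) (MvPolynomial.X x)) K := by
    rw [map_regDetSum χ l m _ hA]
    congr 1
    funext x
    exact MvPolynomial.eval₂Hom_X' _ _ _
  let ι : R →+* MvPolynomial (ℕ × ℕ) Z := MvPolynomial.map (algebraMap ℤ Z)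
  have hψι : ∀ r, ψ (ι r) = toRQ r := by
    intro r
    simp only [ψ, ι, toRQ, MvPolynomial.map_map]
    congr 2
    exact RingHom.ext_int _ _
  have hχι : ∀ r, χ (ι r) = Ideal.Quotient.mk (Ideal.span {(p : R)}) r := by
    intro r
    have : χ.comp ι = Ideal.Quotient.mk (Ideal.span {(p : R)}) := by
      refine MvPolynomial.ringHom_ext (fun c => ?_) fun x => ?_
      · simp
      · simp [χ, ι]
    exact congrArg (fun f => f r) this
  let := MvPolynomial.algebraMvPolynomial (σ := ℕ × ℕ) (R := ℤ) (S := Z)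
  -- `Z[t]` is the localization of `ℤ[t]` at the integers prime to `p`; this provides the fraction
  -- `r / s`.
  obtain ⟨⟨r, s⟩, hrs⟩ := IsLocalization.surj (𝔭.primeCompl.map (MvPolynomial.C (σ := ℕ × ℕ)))
    (regDetSum l m MvPolynomial.X K : MvPolynomial (ℕ × ℕ) Z)
  obtain ⟨_, s, hs, rfl⟩ := s
  have hrs' : regDetSum l m MvPolynomial.X K * (s : MvPolynomial (ℕ × ℕ) Z) = ι r := by
    refine Eq.trans ?_ hrs
    congr 1
    change _ = ι (MvPolynomial.C s)
    simp
  refine ⟨r, s, hcop s hs, ?_, ?_⟩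
  · rw [evalₐ_regDetLimit, ← hψι, ← hrs', map_mul, hψ, map_intCast, map_mul, map_intCast, mul_comm]
  · have h1 := congrArg χ hrs'
    rw [map_mul, hχ, map_intCast, hχι] at h1
    rw [← h1, mul_comm _ (s : RedMod R p), ← mul_sub]
    exact Ideal.mul_mem_left _ _ (pDet_sub_regDetSum_mem l m hp hK)

end PDet

end

theorem theorem3 (n : ℕ) (l : Fin n → ℤ) (hl : Monotone l) (m : ℕ) :
    ∃ L : PDet.CompletedRat, ∃ C : ℝ, 0 < C ∧ ∀ p : ℕ, p.Prime →
      PDet.CongrMod p ⌈C * (p : ℝ)⌉₊ (PDet.pDet l m p) L := by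
  -- Chosen so that `2 * radius l + (2 * m + n + 1) * k + 1 ≤ k * c` for all `k ≥ 1`.
  let c : ℕ := 2 * PDet.radius l + 2 * m + n + 3
  have hc : (0 : ℝ) < ((m + 1) * c : ℕ) := by
    have : 0 < (m + 1) * c := by positivity
    exact_mod_cast this
  refine ⟨PDet.regDetLimit l m, 1 / ((m + 1) * c : ℕ), by positivity, fun p hp => ?_⟩
  have h𝔭 : (Ideal.span {(p : ℤ)}).IsPrime :=
    (Ideal.span_singleton_prime (by exact_mod_cast hp.ne_zero)).mpr (Nat.prime_iff_prime_int.mp hp)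
  refine PDet.congrMod_regDetLimit (Localization.AtPrime (Ideal.span {(p : ℤ)})) hp l m fun k hk1 hk2 => ?_
  set K := ⌈1 / (((m + 1) * c : ℕ) : ℝ) * (p : ℝ)⌉₊ with hK
  -- The relevant `k` satisfy `k ≤ (m + 1) * d` with `d = K - 1 < p / ((m + 1) * c)`. For small
  -- primes `d = 0`, and no `k ≥ 1` is left.
  obtain ⟨d, hd⟩ : ∃ d, K = d + 1 := Nat.exists_eq_succ_of_ne_zero (by
    rintro h
    rw [h] at hk2
    omega)
  have h1 : (d : ℝ) < 1 / (((m + 1) * c : ℕ) : ℝ) * (p : ℝ) := by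
    rw [← Nat.lt_ceil, ← hK]
    omega
  rw [one_div, inv_mul_eq_div, lt_div_iff₀ hc] at h1
  have h2 : d * ((m + 1) * c) < p := by exact_mod_cast h1
  have h3 : k ≤ (m + 1) * d := by
    rw [hd, mul_add] at hk2
    omega
  have h4 : k * c ≤ (m + 1) * d * c := Nat.mul_le_mul_right c h3
  have h5 : 2 * PDet.radius l ≤ k * (2 * PDet.radius l) := Nat.le_mul_of_pos_left _ hk1
  calc 2 * PDet.radius l + (2 * m + n + 1) * k + 1
      ≤ k * c := by simp only [c]; nlinarith
    _ ≤ (m + 1) * d * c := h4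
    _ = d * ((m + 1) * c) := by ring
    _ < p := h2
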